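/- Let $b>0$ with $b\notin\frac12+\mathbb N$ ($\mathbb N=\{0,1,2,\dots\}$), let $q(x)=b^2(e^{-2x}-2e^{-x})$, and let $N=\#\{n\in\mathbb N : n<b-\frac12\}$. Then $N=\lfloor b+\frac12\rfloor$ and $2b-2N>-1$. Let $$L_n^{(\alpha)}(z)=\sum_{k=0}^n \frac{(-1)^k(\alpha+k+1)_{n-k}}{(n-k)!\,k!}\,z^k$$ be the Laguerre polynomials, where $(a)_m=a(a+1)\cdots(a+m-1)$, and for $n\in\mathbb N$ put $$y_n(x)=(2b)^{b-N+\frac12}\sqrt{\frac{n!}{\Gamma(2b-2N+n+1)}}\;e^{-(b-N+\frac12)x}\,e^{-be^{-x}}\,L_n^{(2b-2N)}(2be^{-x}),\qquad x\in\mathbb R .$$ Let $H=-\frac{d^2}{dx^2}+q$ be the operator on $L^2(\mathbb R)$ (complex-valued functions) associated with the quadratic form $(g,f)\mapsto\int \overline{g'}f'+\int q\,\overline g f$ on the form domain $Q=\{f\in H^1(\mathbb R):\int|q||f|^2<\infty\}$; that is, $f\in D(H)$ and $Hf=h$ iff $f\in Q$, $h\in L^2(\mathbb R)$ and $\int \overline{g'}f'+\int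 q\,\overline gf=\int\overline g h$ for all $g\in Q$. Then: 1. $\{y_n\}_{n\ge0}$ is an orthonormal basis of $L^2(\mathbb R)$. 2. Every $y_n$ is smooth and lies in $D(H)$, and for all $n\ge 0$ $$\Bigl(-\frac{d^2}{dx^2}+q\Bigr)y_n=-(1-N+n)\sqrt{(n+1)(2b-2N+n+1)}\;y_{n+1}+\Bigl(-(N-b-\tfrac12)^2+(1-N+n)(2n+2b-2N+1)-n\Bigr)y_n-(n-N)\sqrt{n(2b-2N+n)}\;y_{n-1},$$ both pointwise on $\mathbb R$ and as an identity for $Hy_n$ in $L^2(\mathbb R)$ (the last term is absent for $n=0$). 3. Let $\mathcal H^-=\mathrm{span}\{y_n\}_{n<N}$ and $\mathcal H^+=\overline{\mathrm{span}}\{y_n\}_{n\ge N}$. Then $\dim\mathcal H^-=N$, $\mathcal H^+=(\mathcal H^-)^\perp$, $\mathcal H^-\subset D(H)$, and both subspaces are invariant under $H$: $H\mathcal H^-\subset\mathcal H^-$ and $H(\mathcal H^+\cap D(H))\subset\mathcal H^+$. -/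

import Mathlib

open MeasureTheory
open scoped ContDiff

/-- The complex Hilbert space `L²(ℝ)` (Lebesgue measure). -/
abbrev L2R : Type := Lp ℂ 2 (volume : Measure ℝ)

/-- The generalized Laguerre polynomial
`L_n^{(α)}(z) = ∑_{k=0}^n (-1)^k ((α+k+1)_{n-k} / (n-k)!) z^k / k!`, where
`(α+k+1)_{n-k} / (n-k)!` is the generalized binomial coefficient `C(n+α, n-k)`. -/
noncomputable def laguerrePoly (α : ℝ) (n : ℕ) : Polynomial ℝ :=
  ∑ k ∈ Finset.range (n + 1),
    Polynomial.monomial k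
      ((-1) ^ k * (ascPochhammer ℝ (n - k)).eval (α + k + 1) /
        ((Nat.factorial (n - k) : ℝ) * (Nat.factorial k : ℝ)))

/-- The Morse potential `q(x) = b² (e^{-2x} - 2 e^{-x})`. -/
noncomputable def morsePotential (b x : ℝ) : ℝ :=
  b ^ 2 * (Real.exp (-2 * x) - 2 * Real.exp (-x))

/-- The function
`y_n(x) = (2b)^{b-N+1/2} √(n! / Γ(2b-2N+n+1)) e^{-(b-N+1/2)x} e^{-b e^{-x}} L_n^{(2b-2N)}(2b e^{-x})`. -/
noncomputable def morseY (b : ℝ) (N n : ℕ) (x : ℝ) : ℝ :=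
  (2 * b) ^ (b - N + 1 / 2) *
    Real.sqrt ((Nat.factorial n : ℝ) / Real.Gamma (2 * b - 2 * N + n + 1)) *
    Real.exp (-(b - N + 1 / 2) * x) * Real.exp (-b * Real.exp (-x)) *
    (laguerrePoly (2 * b - 2 * N) n).eval (2 * b * Real.exp (-x))

/-- The differential expression `-f'' + q f`, pointwise. -/
noncomputable def morseDiffExpr (b : ℝ) (f : ℝ → ℝ) (x : ℝ) : ℝ :=
  -iteratedDeriv 2 f x + morsePotential b x * f x

/-- `g ∈ L²(ℝ)` is the weak derivative of `f ∈ L²(ℝ)`. -/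
def IsWeakDerivL2 (f g : L2R) : Prop :=
  ∀ φ : ℝ → ℝ, ContDiff ℝ ∞ φ → HasCompactSupport φ →
    ∫ x, deriv φ x • f x = -∫ x, φ x • g x

lemma integrable_test_smul {φ : ℝ → ℝ} (hφ : Continuous φ) (hc : HasCompactSupport φ) (f : L2R) :
    Integrable (fun x => φ x • f x) :=
  ((Lp.memLp f).locallyIntegrable (by norm_num)).integrable_smul_left_of_hasCompactSupport hφ hc

lemma IsWeakDerivL2.add {f f' g g' : L2R} (hf : IsWeakDerivL2 f f') (hg : IsWeakDerivL2 g g') :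
    IsWeakDerivL2 (f + g) (f' + g') := by
  intro φ h1 h2
  have hd : Continuous (deriv φ) := h1.continuous_deriv (by simp)
  have e1 : ∫ x, deriv φ x • (f + g) x = ∫ x, (deriv φ x • f x + deriv φ x • g x) := by
    apply integral_congr_ae
    filter_upwards [Lp.coeFn_add f g] with x hx
    rw [hx, Pi.add_apply, smul_add]
  have e2 : ∫ x, φ x • (f' + g') x = ∫ x, (φ x • f' x + φ x • g' x) := by
    apply integral_congr_ae
    filter_upwards [Lp.coeFn_add f' g'] with x hx
    rw [hx, Pi.add_apply, smul_add]
  rw [e1, e2, integral_add (integrable_test_smul hd h2.deriv f)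
    (integrable_test_smul hd h2.deriv g),
    integral_add (integrable_test_smul h1.continuous h2 f')
    (integrable_test_smul h1.continuous h2 g'), hf φ h1 h2, hg φ h1 h2]
  ring

lemma IsWeakDerivL2.smul {f f' : L2R} (c : ℂ) (hf : IsWeakDerivL2 f f') :
    IsWeakDerivL2 (c • f) (c • f') := by
  intro φ h1 h2
  have e1 : ∫ x, deriv φ x • (c • f) x = ∫ x, c • (deriv φ x • f x) := by
    apply integral_congr_ae
    filter_upwards [Lp.coeFn_smul c f] with x hx
    rw [hx, Pi.smul_apply, smul_comm]
  have e2 : ∫ x, φ x • (c • f') x = ∫ x, c • (φ x • f' x) := by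
    apply integral_congr_ae
    filter_upwards [Lp.coeFn_smul c f'] with x hx
    rw [hx, Pi.smul_apply, smul_comm]
  rw [e1, e2, integral_smul, integral_smul, hf φ h1 h2, smul_neg]

lemma eq_zero_of_test_integral_eq_zero (f : L2R)
    (h : ∀ φ : ℝ → ℝ, ContDiff ℝ ∞ φ → HasCompactSupport φ → ∫ x, φ x • f x = 0) : f = 0 := by
  rw [Lp.eq_zero_iff_ae_eq_zero]
  exact ae_eq_zero_of_integral_contDiff_smul_eq_zero
    ((Lp.memLp f).locallyIntegrable (by norm_num)) h

lemma IsWeakDerivL2.zero : IsWeakDerivL2 0 0 := by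
  intro φ _ _
  have e : ∀ ψ : ℝ → ℝ, ∫ x, ψ x • (0 : L2R) x = 0 := by
    intro ψ
    rw [← integral_zero ℝ ℂ (μ := volume)]
    apply integral_congr_ae
    filter_upwards [Lp.coeFn_zero ℂ 2 (volume : Measure ℝ)] with x hx
    rw [hx]; simp
  rw [e, e, neg_zero]

lemma IsWeakDerivL2.eq_zero {g : L2R} (h : IsWeakDerivL2 0 g) : g = 0 := by
  apply eq_zero_of_test_integral_eq_zero
  intro φ h1 h2
  have h3 := h φ h1 h2
  rw [IsWeakDerivL2.zero φ h1 h2] at h3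
  have e : ∫ x, φ x • (0 : L2R) x = 0 := by
    rw [← integral_zero ℝ ℂ (μ := volume)]
    apply integral_congr_ae
    filter_upwards [Lp.coeFn_zero ℂ 2 (volume : Measure ℝ)] with x hx
    rw [hx]; simp
  rw [e] at h3
  simpa using h3.symm

/-- The form domain `{f ∈ H¹(ℝ) : ∫ |q| |f|² < ∞}` of the Morse Schrödinger operator. An element is
recorded as the pair `(f, f')` of the function and its weak derivative. -/
noncomputable def morseFormDomain (b : ℝ) : Submodule ℂ (L2R × L2R) where
  carrier := {p | IsWeakDerivL2 p.1 p.2 ∧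
    MemLp (fun x => Real.sqrt |morsePotential b x| • p.1 x) 2 volume}
  add_mem' := by
    rintro p r ⟨h1, h2⟩ ⟨h3, h4⟩
    refine ⟨h1.add h3, (memLp_congr_ae ?_).mp (h2.add h4)⟩
    filter_upwards [Lp.coeFn_add p.1 r.1] with x hx
    rw [Prod.fst_add, hx, Pi.add_apply, Pi.add_apply, smul_add]
  zero_mem' := by
    refine ⟨IsWeakDerivL2.zero, (memLp_congr_ae ?_).mp (MemLp.zero (p := 2))⟩
    filter_upwards [Lp.coeFn_zero ℂ 2 (volume : Measure ℝ)] with x hx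
    rw [Prod.fst_zero, hx]; simp
  smul_mem' := by
    rintro c p ⟨h1, h2⟩
    refine ⟨h1.smul c, (memLp_congr_ae ?_).mp (h2.const_smul c)⟩
    filter_upwards [Lp.coeFn_smul c p.1] with x hx
    rw [Prod.smul_fst, hx, Pi.smul_apply, Pi.smul_apply, smul_comm]

/-- The quadratic form `⟨g', f'⟩ + ∫ q ḡ f`, for the pairs `p = (g, g')` and `r = (f, f')`
(conjugate-linear in `p`, linear in `r`). -/
noncomputable def morseForm (b : ℝ) (p r : L2R × L2R) : ℂ :=
  inner ℂ p.2 r.2 + ∫ x, (morsePotential b x : ℂ) * (starRingEnd ℂ (p.1 x) * r.1 x)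

lemma continuous_morsePotential (b : ℝ) : Continuous (morsePotential b) := by
  unfold morsePotential; fun_prop

lemma integrable_morseForm {b : ℝ} {p r : L2R × L2R} (hp : p ∈ morseFormDomain b)
    (hr : r ∈ morseFormDomain b) :
    Integrable (fun x => (morsePotential b x : ℂ) * (starRingEnd ℂ (p.1 x) * r.1 x)) := by
  have h := MemLp.integrable_mul (p := 2) (q := 2) hp.2.norm hr.2.norm
  refine h.mono ?_ (Filter.Eventually.of_forall fun x => ?_)
  · refine AEStronglyMeasurable.mul ?_ (AEStronglyMeasurable.mul ?_ ?_)
    · exact (Complex.continuous_ofReal.comp (continuous_morsePotential b)).aestronglyMeasurable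
    · exact Complex.continuous_conj.comp_aestronglyMeasurable (Lp.aestronglyMeasurable p.1)
    · exact Lp.aestronglyMeasurable r.1
  · have hs := Real.mul_self_sqrt (abs_nonneg (morsePotential b x))
    simp only [norm_mul, Complex.norm_real, Real.norm_eq_abs, RCLike.norm_conj, Pi.mul_apply,
      norm_smul, abs_norm, abs_of_nonneg (Real.sqrt_nonneg _)]
    apply le_of_eq
    calc |morsePotential b x| * (‖p.1 x‖ * ‖r.1 x‖)
        = (√|morsePotential b x| * √|morsePotential b x|) * (‖p.1 x‖ * ‖r.1 x‖) := by rw [hs]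
      _ = _ := by ring

lemma morseForm_add {b : ℝ} {p r s : L2R × L2R} (hp : p ∈ morseFormDomain b)
    (hr : r ∈ morseFormDomain b) (hs : s ∈ morseFormDomain b) :
    morseForm b p (r + s) = morseForm b p r + morseForm b p s := by
  have e : ∫ x, (morsePotential b x : ℂ) * (starRingEnd ℂ (p.1 x) * (r + s).1 x)
      = ∫ x, ((morsePotential b x : ℂ) * (starRingEnd ℂ (p.1 x) * r.1 x)
        + (morsePotential b x : ℂ) * (starRingEnd ℂ (p.1 x) * s.1 x)) := by
    apply integral_congr_ae
    filter_upwards [Lp.coeFn_add r.1 s.1] with x hx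
    rw [Prod.fst_add, hx, Pi.add_apply]; ring
  unfold morseForm
  rw [e, integral_add (integrable_morseForm hp hr) (integrable_morseForm hp hs), Prod.snd_add,
    inner_add_right]
  ring

lemma morseForm_smul (b : ℝ) (p r : L2R × L2R) (c : ℂ) :
    morseForm b p (c • r) = c * morseForm b p r := by
  have e : ∫ x, (morsePotential b x : ℂ) * (starRingEnd ℂ (p.1 x) * (c • r).1 x)
      = ∫ x, c * ((morsePotential b x : ℂ) * (starRingEnd ℂ (p.1 x) * r.1 x)) := by
    apply integral_congr_ae
    filter_upwards [Lp.coeFn_smul c r.1] with x hx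
    rw [Prod.smul_fst, hx, Pi.smul_apply, smul_eq_mul]; ring
  unfold morseForm
  rw [e, integral_const_mul, Prod.smul_snd, inner_smul_right]
  ring

lemma morseForm_zero (b : ℝ) (p : L2R × L2R) : morseForm b p 0 = 0 := by
  have := morseForm_smul b p 0 0
  simpa using this

/-- The graph of the operator associated with the form: the pairs `(f, h)` such that `f` is in the
form domain and the form satisfies `form(g, f) = ⟨g, h⟩` for all `g` in the form domain. -/
noncomputable def morseGraph (b : ℝ) : Submodule ℂ (L2R × L2R) where
  carrier := {u | ∃ f' : L2R, (u.1, f') ∈ morseFormDomain b ∧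
    ∀ p ∈ morseFormDomain b, morseForm b p (u.1, f') = inner ℂ p.1 u.2}
  add_mem' := by
    rintro u v ⟨f', hf, h1⟩ ⟨g', hg, h2⟩
    refine ⟨f' + g', (morseFormDomain b).add_mem hf hg, fun p hp => ?_⟩
    have := morseForm_add hp hf hg
    rw [Prod.mk_add_mk] at this
    rw [Prod.fst_add, this, h1 p hp, h2 p hp, Prod.snd_add, inner_add_right]
  zero_mem' := by
    refine ⟨0, (morseFormDomain b).zero_mem, fun p _ => ?_⟩
    rw [Prod.snd_zero, inner_zero_right]
    exact morseForm_zero b p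
  smul_mem' := by
    rintro c u ⟨f', hf, h1⟩
    refine ⟨c • f', (morseFormDomain b).smul_mem c hf, fun p hp => ?_⟩
    have := morseForm_smul b p (u.1, f') c
    rw [Prod.smul_mk] at this
    rw [Prod.smul_fst, this, h1 p hp, Prod.smul_snd, inner_smul_right]

/-- Test functions belong to the form domain. -/
lemma test_mem_morseFormDomain (b : ℝ) {φ : ℝ → ℝ} (h1 : ContDiff ℝ ∞ φ)
    (h2 : HasCompactSupport φ) :
    ∃ p ∈ morseFormDomain b, p.1 =ᵐ[volume] fun x => (φ x : ℂ) := by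
  have hd : Continuous (deriv φ) := h1.continuous_deriv (by simp)
  have hL : ∀ ψ : ℝ → ℝ, Continuous ψ → HasCompactSupport ψ →
      MemLp (fun x => (ψ x : ℂ)) 2 (volume : Measure ℝ) := fun ψ hψ hc =>
    (Complex.continuous_ofReal.comp hψ).memLp_of_hasCompactSupport
      (hc.comp_left (g := ((↑) : ℝ → ℂ)) Complex.ofReal_zero)
  refine ⟨((hL φ h1.continuous h2).toLp _, (hL _ hd h2.deriv).toLp _), ⟨?_, ?_⟩,
    MemLp.coeFn_toLp (hL φ h1.continuous h2)⟩
  · intro χ h3 h4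
    have hd' : Continuous (deriv χ) := h3.continuous_deriv (by simp)
    have e1 : ∫ x, deriv χ x • (hL φ h1.continuous h2).toLp _ x
        = ∫ x, ((deriv χ x * φ x : ℝ) : ℂ) := by
      apply integral_congr_ae
      filter_upwards [MemLp.coeFn_toLp (hL φ h1.continuous h2)] with x hx
      rw [hx]; simp
    have e2 : ∫ x, χ x • (hL _ hd h2.deriv).toLp _ x = ∫ x, ((χ x * deriv φ x : ℝ) : ℂ) := by
      apply integral_congr_ae
      filter_upwards [MemLp.coeFn_toLp (hL _ hd h2.deriv)] with x hx
      rw [hx]; simp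
    have key : ∫ x, χ x * deriv φ x = -∫ x, deriv χ x * φ x := by
      refine integral_mul_deriv_eq_deriv_mul_of_integrable
        (fun x _ => (h3.differentiable (by simp) x).hasDerivAt)
        (fun x _ => (h1.differentiable (by simp) x).hasDerivAt) ?_ ?_ ?_
      · exact (h3.continuous.mul hd).integrable_of_hasCompactSupport h4.mul_right
      · exact (hd'.mul h1.continuous).integrable_of_hasCompactSupport h2.mul_left
      · exact (h3.continuous.mul h1.continuous).integrable_of_hasCompactSupport h2.mul_left
    change ∫ x, deriv χ x • (hL φ h1.continuous h2).toLp _ x =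
      -∫ x, χ x • (hL _ hd h2.deriv).toLp _ x
    rw [e1, e2, integral_complex_ofReal, integral_complex_ofReal, key]
    simp
  · have hc : Continuous fun x => Real.sqrt |morsePotential b x| * φ x :=
      ((continuous_morsePotential b).abs.sqrt).mul h1.continuous
    refine (memLp_congr_ae ?_).mp (hL _ hc h2.mul_left)
    filter_upwards [MemLp.coeFn_toLp (hL φ h1.continuous h2)] with x hx
    rw [hx]; simp

/-- The form domain is dense, so the graph is that of a single-valued operator. -/
lemma morseGraph_single_valued (b : ℝ) :
    ∀ u ∈ morseGraph b, u.1 = 0 → u.2 = 0 := by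
  rintro ⟨f, h⟩ ⟨f', hf, hform⟩ hu
  dsimp only at hu hf hform ⊢
  subst hu
  have hf' : f' = 0 := IsWeakDerivL2.eq_zero hf.1
  subst hf'
  apply eq_zero_of_test_integral_eq_zero
  intro φ h1 h2
  obtain ⟨p, hp, hpφ⟩ := test_mem_morseFormDomain b h1 h2
  have h3 := hform p hp
  have h4 : morseForm b p ((0 : L2R), (0 : L2R)) = 0 := morseForm_zero b p
  rw [h4, L2.inner_def] at h3
  rw [h3]
  apply integral_congr_ae
  filter_upwards [hpφ] with x hx
  rw [hx]
  simp [mul_comm]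

/-- The Schrödinger operator `-d²/dx² + b² (e^{-2x} - 2 e^{-x})` on `L²(ℝ)`, with its natural
(form-theoretic) domain. -/
noncomputable def morseOperator (b : ℝ) : L2R →ₗ.[ℂ] L2R :=
  (morseGraph b).toLinearPMap

lemma morseOperator_graph (b : ℝ) : (morseOperator b).graph = morseGraph b :=
  Submodule.toLinearPMap_graph_eq _ (morseGraph_single_valued b)

/-- A subspace `V` is invariant under the (unbounded) operator `A` if `A f ∈ V` for all
`f ∈ V` in the domain of `A`. -/
def IsInvariantUnder (A : L2R →ₗ.[ℂ] L2R) (V : Submodule ℂ L2R) : Prop :=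
  ∀ f : A.domain, (f : L2R) ∈ V → A f ∈ V

/-!
The substitution `z = 2b e^{-x}` turns `L²(ℝ, dx)` into `L²((0, ∞), dz/z)` and the functions `y_n`
into normalised multiples of `z^s e^{-z/2} L_n^{(α)}(z)` with `α = 2b - 2N > -1` and
`s = (α + 1) / 2 = b - N + 1/2`. Accordingly everything is done on the class of functions
`F_P(x) = e^{-sx} e^{-b e^{-x}} P(2b e^{-x})` with `P` a polynomial (`morseFun`). This class is stable
under `d/dx` and under multiplication by the potential, so that `-d²/dx² + q` becomes an operator on
polynomials (`morseSchrodingerPoly`).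

*Tridiagonal formula.* On polynomials it is an algebraic consequence of Laguerre's equation and the
raising relation (`morsePoly_tridiagonal`); the lowering relation then identifies the lower
neighbour. All three follow from two-term recursions for the coefficients of `L_n^{(α)}`.

*Orthonormality.* By Euler's integral, `∫ z^{α+k} e^{-z} L_n^{(α)}(z) dz` is, up to a factor, the
`n`-th finite difference of a polynomial of degree `k`
(`laguerrePoly_sum_coeff_mul_Gamma`), so it vanishes for `k < n` and is explicit for `k = n`.

*Completeness.* Let `f` be orthogonal to all `F_P`. Expanding `e^{-τ e^{-x}}` in its power series
shows, in finitely many steps of bounded length, that `f` is orthogonal to `F_1 u^m` for all `m`,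
where `u = e^{-(b/2) e^{-x}}` maps `ℝ` homeomorphically onto `(0, 1)`. By the Weierstrass
approximation theorem `f F_1` annihilates every test function, whence `f = 0`
(`eq_zero_of_forall_integral_morseFun_smul_eq_zero`).

*The operator.* Each `F_P` lies in the form domain, and a cutoff argument allows `F_P'` as a test
function in the definition of the weak derivative, which puts `F_P` in the domain of the operator,
with the pointwise action (`morseVec_mem_morseGraph`). The coefficient of `y_{n+1}` in `H y_n`
vanishes at `n = N - 1`, so the span of the first `N` functions is invariant; its orthogonal
complement is invariant because the operator is symmetric.
-/

/-! ### Laguerre polynomials -/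

section Laguerre

open Polynomial

lemma laguerrePoly_coeff (α : ℝ) (n k : ℕ) :
    (laguerrePoly α n).coeff k =
      if k ≤ n then (-1) ^ k * (ascPochhammer ℝ (n - k)).eval (α + k + 1) /
        ((Nat.factorial (n - k) : ℝ) * (Nat.factorial k : ℝ)) else 0 := by
  unfold laguerrePoly
  rw [finsetSum_coeff]
  simp only [coeff_monomial, Finset.sum_ite_eq', Finset.mem_range, Nat.lt_succ_iff]

lemma laguerrePoly_coeff_of_lt {α : ℝ} {n k : ℕ} (h : n < k) : (laguerrePoly α n).coeff k = 0 := by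
  rw [laguerrePoly_coeff, if_neg (by omega)]

lemma laguerrePoly_coeff_self (α : ℝ) (n : ℕ) :
    (laguerrePoly α n).coeff n = (-1) ^ n / (n.factorial : ℝ) := by
  simp [laguerrePoly_coeff]

lemma laguerrePoly_natDegree_le (α : ℝ) (n : ℕ) : (laguerrePoly α n).natDegree ≤ n :=
  natDegree_le_iff_coeff_eq_zero.2 fun _ h => laguerrePoly_coeff_of_lt h

lemma laguerrePoly_degree (α : ℝ) (n : ℕ) : (laguerrePoly α n).degree = n := by
  refine degree_eq_of_le_of_coeff_ne_zero
    (natDegree_le_iff_degree_le.1 (laguerrePoly_natDegree_le α n)) ?_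
  rw [laguerrePoly_coeff_self]
  positivity

lemma laguerrePoly_coeff_succ_left (α : ℝ) (n k : ℕ) :
    ((n : ℝ) + 1 - k) * (laguerrePoly α (n + 1)).coeff k =
      (α + n + 1) * (laguerrePoly α n).coeff k := by
  rcases Nat.lt_or_ge n k with h | h
  · rw [laguerrePoly_coeff_of_lt h]
    rcases Nat.lt_or_ge (n + 1) k with h' | h'
    · rw [laguerrePoly_coeff_of_lt h']; simp
    · obtain rfl : k = n + 1 := by omega
      simp
  · obtain ⟨m, rfl⟩ := Nat.exists_eq_add_of_le h
    rw [laguerrePoly_coeff, laguerrePoly_coeff, if_pos (by omega), if_pos (by omega)]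
    rw [show k + m + 1 - k = m + 1 by omega, show k + m - k = m by omega,
      ascPochhammer_succ_eval, Nat.factorial_succ]
    have := Nat.factorial_pos m
    have := Nat.factorial_pos k
    push_cast
    field_simp
    ring

lemma laguerrePoly_coeff_succ_right (α : ℝ) (n k : ℕ) :
    ((k : ℝ) + 1) * (α + k + 1) * (laguerrePoly α n).coeff (k + 1) =
      -((n : ℝ) - k) * (laguerrePoly α n).coeff k := by
  rcases Nat.lt_or_ge n (k + 1) with h | h
  · rw [laguerrePoly_coeff_of_lt h]
    rcases Nat.lt_or_ge n k with h' | h'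
    · rw [laguerrePoly_coeff_of_lt h']; simp
    · obtain rfl : k = n := by omega
      simp
  · obtain ⟨m, rfl⟩ := Nat.exists_eq_add_of_le h
    rw [laguerrePoly_coeff, laguerrePoly_coeff, if_pos (by omega), if_pos (by omega)]
    rw [show k + 1 + m - k = m + 1 by omega, show k + 1 + m - (k + 1) = m by omega,
      ascPochhammer_succ_left, Nat.factorial_succ, Nat.factorial_succ, eval_mul, eval_comp]
    have := Nat.factorial_pos m
    have := Nat.factorial_pos k
    simp only [eval_X, eval_add, eval_one]
    push_cast
    rw [show α + (k + 1) + 1 = α + k + 1 + 1 by ring]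
    field_simp
    ring

lemma X_mul_derivative_coeff (P : ℝ[X]) (k : ℕ) : (X * derivative P).coeff k = k * P.coeff k := by
  cases k with
  | zero => simp
  | succ k => rw [coeff_X_mul, coeff_derivative]; push_cast; ring

/-- The lowering relation `(n+1) L_{n+1} - z L_{n+1}' = (α+n+1) L_n`. -/
lemma laguerrePoly_lowering (α : ℝ) (n : ℕ) :
    C ((n : ℝ) + 1) * laguerrePoly α (n + 1) - X * derivative (laguerrePoly α (n + 1)) =
      C (α + n + 1) * laguerrePoly α n := by
  ext k
  rw [coeff_sub, coeff_C_mul, coeff_C_mul, X_mul_derivative_coeff, ← laguerrePoly_coeff_succ_left]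
  ring

/-- The raising relation `z L_n' = (n+1) L_{n+1} - (α+n+1-z) L_n`. -/
lemma laguerrePoly_raising (α : ℝ) (n : ℕ) :
    X * derivative (laguerrePoly α n) =
      C ((n : ℝ) + 1) * laguerrePoly α (n + 1) - C (α + n + 1) * laguerrePoly α n
        + X * laguerrePoly α n := by
  ext k
  rw [coeff_add, coeff_sub, coeff_C_mul, coeff_C_mul, X_mul_derivative_coeff,
    ← laguerrePoly_coeff_succ_left]
  cases k with
  | zero => simp
  | succ j =>
    rw [coeff_X_mul]
    have h1 := laguerrePoly_coeff_succ_left α n (j + 1)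
    have h2 := laguerrePoly_coeff_succ_right α n j
    push_cast at h1 h2 ⊢
    rcases lt_trichotomy n j with h | h | h
    · rw [laguerrePoly_coeff_of_lt h, laguerrePoly_coeff_of_lt (by omega : n < j + 1),
        laguerrePoly_coeff_of_lt (by omega : n + 1 < j + 1)]
      ring
    · subst h
      rw [laguerrePoly_coeff_of_lt (by omega : n < n + 1), laguerrePoly_coeff_self,
        laguerrePoly_coeff_self, Nat.factorial_succ]
      have := Nat.factorial_pos n
      push_cast
      field_simp
      ring
    · -- the two coefficient recursions give the identity multiplied by `n - j ≠ 0`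
      have hne : ((n : ℝ) - j) ≠ 0 := sub_ne_zero.2 (by exact_mod_cast h.ne')
      apply mul_left_cancel₀ hne
      linear_combination (-((j : ℝ) + 1)) * h1 - h2

/-- Laguerre's differential equation `z L_n'' + (α+1-z) L_n' + n L_n = 0`. -/
lemma laguerrePoly_ode (α : ℝ) (n : ℕ) :
    X * derivative (derivative (laguerrePoly α n)) + C (α + 1) * derivative (laguerrePoly α n)
      - X * derivative (laguerrePoly α n) + C (n : ℝ) * laguerrePoly α n = 0 := by
  ext k
  rw [coeff_add, coeff_sub, coeff_add, coeff_C_mul, coeff_C_mul, X_mul_derivative_coeff,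
    X_mul_derivative_coeff, coeff_derivative, coeff_zero]
  linear_combination laguerrePoly_coeff_succ_right α n k

lemma Real.Gamma_add_natCast_eq_ascPochhammer {x : ℝ} (hx : 0 < x) (m : ℕ) :
    Real.Gamma (x + m) = (ascPochhammer ℝ m).eval x * Real.Gamma x := by
  induction m with
  | zero => simp
  | succ m ih =>
    rw [ascPochhammer_succ_eval, Nat.cast_succ, ← add_assoc, Real.Gamma_add_one (by positivity), ih]
    ring

lemma sum_alternating_choose_mul_ascPochhammer (x : ℝ) {n k : ℕ} (hk : k ≤ n) :
    ∑ j ∈ Finset.range (n + 1), (-1 : ℝ) ^ j * n.choose j * (ascPochhammer ℝ k).eval (x + j) =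
      if k = n then (-1) ^ n * (n.factorial : ℝ) else 0 := by
  have h := fwdDiff_iter_eq_sum_shift (1 : ℝ) (ascPochhammer ℝ k).eval n x
  have h' : (fwdDiff (1 : ℝ))^[n] (ascPochhammer ℝ k).eval x
      = if k = n then (n.factorial : ℝ) else 0 := by
    split_ifs with hkn
    · subst hkn
      have := congrFun (fwdDiff_iter_degree_eq_factorial (ascPochhammer ℝ k)) x
      rw [ascPochhammer_natDegree, (monic_ascPochhammer ℝ k).leadingCoeff] at this
      simpa using this
    · exact congrFun (fwdDiff_iter_eq_zero_of_degree_lt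
        (by rw [ascPochhammer_natDegree]; omega)) x
  rw [h'] at h
  have e : ∀ j ∈ Finset.range (n + 1),
      (-1 : ℝ) ^ j * n.choose j * (ascPochhammer ℝ k).eval (x + j) =
      (-1) ^ n * (((-1 : ℤ) ^ (n - j) * n.choose j) • (ascPochhammer ℝ k).eval (x + j • (1 : ℝ))) := by
    intro j hj
    obtain ⟨m, rfl⟩ := Nat.exists_eq_add_of_le (Nat.lt_succ_iff.1 (Finset.mem_range.1 hj))
    have h1 : (-1 : ℝ) ^ m * (-1) ^ m = 1 := by rw [← mul_pow]; simp
    rw [Nat.add_sub_cancel_left, zsmul_eq_mul, nsmul_eq_mul, mul_one]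
    push_cast
    rw [pow_add]
    linear_combination (-((-1 : ℝ) ^ j * ((j + m).choose j) * (ascPochhammer ℝ k).eval (x + j))) * h1
  rw [Finset.sum_congr rfl e, ← Finset.mul_sum, ← h]
  split_ifs <;> simp

/-- The `k`-th moment of `L_n^{(α)}` for the weight `z^α e^{-z}`, `k ≤ n`: written out through the
Gamma function it is an `n`-th finite difference of the degree-`k` polynomial `(x)_k`. -/
lemma laguerrePoly_sum_coeff_mul_Gamma {α : ℝ} (hα : -1 < α) {n k : ℕ} (hk : k ≤ n) :
    ∑ j ∈ Finset.range (n + 1), (laguerrePoly α n).coeff j * Real.Gamma (α + 1 + (j + k : ℕ)) =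
      if k = n then (-1) ^ n * Real.Gamma (α + n + 1) else 0 := by
  have e : ∀ j ∈ Finset.range (n + 1),
      (laguerrePoly α n).coeff j * Real.Gamma (α + 1 + (j + k : ℕ)) =
      Real.Gamma (α + n + 1) / n.factorial *
        ((-1 : ℝ) ^ j * n.choose j * (ascPochhammer ℝ k).eval (α + 1 + j)) := by
    intro j hj
    obtain ⟨m, rfl⟩ := Nat.exists_eq_add_of_le (Nat.lt_succ_iff.1 (Finset.mem_range.1 hj))
    have hpos : 0 < α + 1 + j := by positivity [neg_lt_iff_pos_add.1 hα]
    have h1 := Real.Gamma_add_natCast_eq_ascPochhammer hpos m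
    have h2 := Real.Gamma_add_natCast_eq_ascPochhammer hpos k
    have h3 : ((j + m).choose j : ℝ) = (j + m).factorial / (j.factorial * m.factorial) := by
      rw [Nat.cast_choose ℝ (by omega), Nat.add_sub_cancel_left]
    rw [laguerrePoly_coeff, if_pos (by omega), Nat.add_sub_cancel_left, h3]
    push_cast
    rw [← add_assoc (α + 1), h2, show α + (j + m) + 1 = α + 1 + j + m by ring, h1,
      show α + j + 1 = α + 1 + j by ring]
    have := Nat.factorial_pos m
    have := Nat.factorial_pos j
    have := Nat.factorial_pos (j + m)
    field_simp
  rw [Finset.sum_congr rfl e, ← Finset.mul_sum, sum_alternating_choose_mul_ascPochhammer _ hk]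
  have := Nat.factorial_pos n
  split_ifs
  · field_simp
  · simp

/-- The action of `d/dx` on the functions `e^{-sx} e^{-b e^{-x}} P(2b e^{-x})`, transported to the
polynomial `P`. -/
noncomputable def morseDerivPoly (s : ℝ) (P : ℝ[X]) : ℝ[X] :=
  -(C s * P) + C (1 / 2) * X * P - X * derivative P

/-- The tridiagonal form of the Schrödinger expression on Laguerre polynomials. The lower
neighbour enters as `n L_n - z L_n' = (n+α) L_{n-1}`, which also makes sense for `n = 0`. -/
lemma morsePoly_tridiagonal (α N : ℝ) (n : ℕ) {s b : ℝ} (hs : s = (α + 1) / 2)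
    (hb : b = s + N - 1 / 2) :
    -morseDerivPoly s (morseDerivPoly s (laguerrePoly α n)) +
        (C (1 / 4) * X ^ 2 - C b * X) * laguerrePoly α n =
      C (-(1 - N + n) * (n + 1)) * laguerrePoly α (n + 1) +
        C (-s ^ 2 + (1 - N + n) * (2 * n + α + 1) - n) * laguerrePoly α n -
        C (n - N) * (C (n : ℝ) * laguerrePoly α n - X * derivative (laguerrePoly α n)) := by
  subst hb hs
  have h1 := laguerrePoly_ode α n
  have h2 := laguerrePoly_raising α n
  refine Polynomial.funext fun z => ?_
  replace h1 := congrArg (eval z) h1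
  replace h2 := congrArg (eval z) h2
  simp only [eval_add, eval_sub, eval_mul, eval_C, eval_X, eval_zero] at h1 h2
  simp only [morseDerivPoly, derivative_add, derivative_sub, derivative_neg, derivative_mul,
    derivative_C, derivative_X, eval_add, eval_sub, eval_mul, eval_C, eval_X, eval_neg, eval_pow,
    eval_zero, eval_one]
  linear_combination (-z) * h1 + (-(1 - N + n)) * h2

end Laguerre

/-! ### The functions `e^{-sx} e^{-b e^{-x}} P(2b e^{-x})` -/

section MorseFun

open Polynomial Real

/-- The weight `e^{-σx} e^{-β e^{-x}}`; under `z = e^{-x}` it is `z^σ e^{-βz}`. -/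
noncomputable def morseWeight (σ β x : ℝ) : ℝ := exp (-σ * x) * exp (-β * exp (-x))

/-- The function `e^{-sx} e^{-b e^{-x}} P(2b e^{-x})`. Up to a constant these are the functions
`z^s e^{-z/2} P(z)` of `z = 2b e^{-x}`. -/
noncomputable def morseFun (b s : ℝ) (P : ℝ[X]) (x : ℝ) : ℝ :=
  morseWeight s b x * P.eval (2 * b * exp (-x))

lemma morseWeight_pos (σ β x : ℝ) : 0 < morseWeight σ β x := by
  unfold morseWeight; positivity

lemma continuous_morseWeight (σ β : ℝ) : Continuous (morseWeight σ β) := by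
  unfold morseWeight; fun_prop

lemma morseWeight_mul_morseWeight (σ σ' β β' x : ℝ) :
    morseWeight σ β x * morseWeight σ' β' x = morseWeight (σ + σ') (β + β') x := by
  simp only [morseWeight, ← Real.exp_add]; congr 1; ring

lemma morseWeight_mul_exp_pow (σ β x : ℝ) (k : ℕ) :
    morseWeight σ β x * exp (-x) ^ k = morseWeight (σ + k) β x := by
  simp only [morseWeight, ← Real.exp_add, ← Real.exp_nat_mul]; congr 1; ring

/-- The substitution `t = e^{-x}` turns the integral of the weight into Euler's integral. -/
lemma integral_morseWeight {σ β : ℝ} (hσ : 0 < σ) (hβ : 0 < β) :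
    ∫ x, morseWeight σ β x = (1 / β) ^ σ * Gamma σ := by
  rw [← integral_rpow_mul_exp_neg_mul_Ioi hσ hβ]
  have himg : (fun x : ℝ => exp (-x)) '' Set.univ = Set.Ioi 0 := by
    rw [Set.image_univ]
    ext t
    exact ⟨by rintro ⟨x, rfl⟩; exact exp_pos _, fun ht => ⟨-log t, by simp [exp_log ht]⟩⟩
  have h := integral_image_eq_integral_abs_deriv_smul (f := fun x : ℝ => exp (-x))
    (f' := fun x => -exp (-x)) MeasurableSet.univ
    (fun x _ => by
      have := ((hasDerivAt_id x).neg.exp).hasDerivWithinAt (s := Set.univ)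
      simpa using this)
    (fun x _ y _ hxy => by simpa using hxy) (fun t => t ^ (σ - 1) * exp (-(β * t)))
  rw [himg, Measure.restrict_univ] at h
  rw [h]
  congr 1
  ext x
  rw [abs_neg, abs_of_pos (exp_pos _), smul_eq_mul, ← exp_mul, morseWeight]
  simp only [← Real.exp_add]
  ring_nf

lemma integrable_morseWeight {σ β : ℝ} (hσ : 0 < σ) (hβ : 0 < β) :
    Integrable (morseWeight σ β) := by
  by_contra h
  have h1 := integral_morseWeight hσ hβ
  rw [integral_undef h] at h1
  have := Gamma_pos_of_pos hσ
  have : 0 < (1 / β) ^ σ * Gamma σ := by positivity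
  linarith

lemma integrable_morseWeight_mul_eval {σ β : ℝ} (hσ : 0 < σ) (hβ : 0 < β) (c : ℝ) (P : ℝ[X]) :
    Integrable (fun x => morseWeight σ β x * P.eval (c * exp (-x))) := by
  induction P using Polynomial.induction_on' with
  | add P Q hP hQ =>
    simp only [eval_add, mul_add]
    exact hP.add hQ
  | monomial k a =>
    have h := (integrable_morseWeight (show 0 < σ + k by positivity) hβ).const_mul (a * c ^ k)
    refine h.congr (Filter.Eventually.of_forall fun x => ?_)
    dsimp only
    rw [eval_monomial, ← morseWeight_mul_exp_pow]
    ring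

lemma memLp_two_morseWeight {σ β : ℝ} (hσ : 0 < σ) (hβ : 0 < β) :
    MemLp (morseWeight σ β) 2 := by
  rw [memLp_two_iff_integrable_sq (continuous_morseWeight σ β).aestronglyMeasurable]
  simp only [sq, morseWeight_mul_morseWeight]
  exact integrable_morseWeight (by positivity) (by positivity)

lemma contDiff_morseFun (b s : ℝ) (P : ℝ[X]) : ContDiff ℝ ∞ (morseFun b s P) := by
  unfold morseFun morseWeight
  refine ContDiff.mul (by fun_prop) ?_
  exact (P.contDiff_aeval ∞).comp (by fun_prop : ContDiff ℝ ∞ fun x : ℝ => 2 * b * exp (-x))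

lemma morseFun_mul_morseFun (b s : ℝ) (P Q : ℝ[X]) (x : ℝ) :
    morseFun b s P x * morseFun b s Q x =
      morseWeight (2 * s) (2 * b) x * (P * Q).eval (2 * b * exp (-x)) := by
  rw [two_mul s, two_mul b, ← morseWeight_mul_morseWeight, ← two_mul, eval_mul]
  simp only [morseFun]
  ring

lemma integrable_morseFun_mul_morseFun {b s : ℝ} (hb : 0 < b) (hs : 0 < s) (P Q : ℝ[X]) :
    Integrable (fun x => morseFun b s P x * morseFun b s Q x) := by
  simp only [morseFun_mul_morseFun]
  exact integrable_morseWeight_mul_eval (by positivity) (by positivity) _ _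

lemma memLp_morseFun {b s : ℝ} (hb : 0 < b) (hs : 0 < s) (P : ℝ[X]) :
    MemLp (morseFun b s P) 2 := by
  rw [memLp_two_iff_integrable_sq (contDiff_morseFun b s P).continuous.aestronglyMeasurable]
  simp only [sq]
  exact integrable_morseFun_mul_morseFun hb hs P P

lemma hasDerivAt_morseFun (b s : ℝ) (P : ℝ[X]) (x : ℝ) :
    HasDerivAt (morseFun b s P) (morseFun b s (morseDerivPoly s P) x) x := by
  have h0 : HasDerivAt (fun x : ℝ => exp (-x)) (-exp (-x)) x := by
    simpa using (hasDerivAt_id x).neg.exp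
  have h1 : HasDerivAt (fun x : ℝ => exp (-s * x)) (exp (-s * x) * (-s)) x := by
    simpa using ((hasDerivAt_id x).const_mul (-s)).exp
  have h2 := (h0.const_mul (-b)).exp
  have h3 := (P.hasDerivAt (2 * b * exp (-x))).comp x (h0.const_mul (2 * b))
  refine ((h1.mul h2).mul h3).congr_deriv ?_
  simp only [morseFun, morseWeight, morseDerivPoly, eval_add, eval_sub, eval_mul, eval_C, eval_X,
    eval_neg, Pi.mul_apply, Function.comp_apply]
  ring

lemma deriv_morseFun (b s : ℝ) (P : ℝ[X]) :
    deriv (morseFun b s P) = morseFun b s (morseDerivPoly s P) :=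
  funext fun x => (hasDerivAt_morseFun b s P x).deriv

lemma morsePotential_mul_morseFun (b s : ℝ) (P : ℝ[X]) (x : ℝ) :
    morsePotential b x * morseFun b s P x =
      morseFun b s ((C (1 / 4) * X ^ 2 - C b * X) * P) x := by
  have h : exp (-2 * x) = exp (-x) ^ 2 := by rw [← Real.exp_nat_mul]; congr 1; push_cast; ring
  simp only [morseFun, morsePotential, h, eval_sub, eval_mul, eval_C, eval_X, eval_pow]
  ring

/-- The moments of the weight, in the variable `z = 2b e^{-x}`. -/
lemma integral_morseWeight_mul_pow {b σ : ℝ} (hb : 0 < b) (hσ : 0 < σ) (k : ℕ) :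
    ∫ x, morseWeight σ (2 * b) x * (2 * b * exp (-x)) ^ k =
      (1 / (2 * b)) ^ σ * Gamma (σ + k) := by
  have e : ∀ x, morseWeight σ (2 * b) x * (2 * b * exp (-x)) ^ k =
      (2 * b) ^ k * morseWeight (σ + k) (2 * b) x := fun x => by
    rw [← morseWeight_mul_exp_pow]; ring
  simp only [e]
  rw [integral_const_mul, integral_morseWeight (by positivity) (by positivity),
    rpow_add_natCast (by positivity)]
  have h1 : (2 * b) ^ k * (1 / (2 * b)) ^ k = 1 := by
    rw [← mul_pow, mul_one_div_cancel (by positivity), one_pow]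
  linear_combination (1 / (2 * b)) ^ σ * Gamma (σ + k) * h1

/-- `L_n^{(α)}` integrates against a polynomial of degree at most `n` to a multiple of its `n`-th
coefficient; in particular it is orthogonal to all polynomials of smaller degree. -/
lemma integral_morseWeight_mul_laguerrePoly_mul {b α : ℝ} (hb : 0 < b) (hα : -1 < α) {n : ℕ}
    {P : ℝ[X]} (hP : P.natDegree ≤ n) :
    ∫ x, morseWeight (α + 1) (2 * b) x * (laguerrePoly α n * P).eval (2 * b * exp (-x)) =
      (1 / (2 * b)) ^ (α + 1) * ((-1) ^ n * Gamma (α + n + 1) * P.coeff n) := by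
  have hα' : 0 < α + 1 := by linarith
  have hint : ∀ k : ℕ, Integrable fun x => morseWeight (α + 1) (2 * b) x *
      (2 * b * exp (-x)) ^ k := fun k => by
    simpa using integrable_morseWeight_mul_eval hα' (by positivity : 0 < 2 * b) (2 * b)
      ((X : ℝ[X]) ^ k)
  have e : ∀ x, morseWeight (α + 1) (2 * b) x *
      (laguerrePoly α n * P).eval (2 * b * exp (-x)) =
      ∑ k ∈ Finset.range (n + 1), ∑ j ∈ Finset.range (n + 1),
        P.coeff k * (laguerrePoly α n).coeff j *
          (morseWeight (α + 1) (2 * b) x * (2 * b * exp (-x)) ^ (j + k)) := by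
    intro x
    rw [eval_mul, eval_eq_sum_range' (Nat.lt_succ_of_le (laguerrePoly_natDegree_le α n)),
      eval_eq_sum_range' (Nat.lt_succ_of_le hP), Finset.sum_mul_sum, Finset.sum_comm,
      Finset.mul_sum]
    refine Finset.sum_congr rfl fun k _ => ?_
    rw [Finset.mul_sum]
    refine Finset.sum_congr rfl fun j _ => ?_
    rw [pow_add]; ring
  simp only [e]
  rw [integral_finsetSum _ fun k _ => integrable_finsetSum _ fun j _ => (hint _).const_mul _]
  have e2 : ∀ k ∈ Finset.range (n + 1), ∫ x, ∑ j ∈ Finset.range (n + 1),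
        P.coeff k * (laguerrePoly α n).coeff j *
          (morseWeight (α + 1) (2 * b) x * (2 * b * exp (-x)) ^ (j + k)) =
      if k = n then (1 / (2 * b)) ^ (α + 1) * ((-1) ^ n * Gamma (α + n + 1) * P.coeff n)
        else 0 := by
    intro k hk
    rw [integral_finsetSum _ fun j _ => (hint _).const_mul _]
    simp only [integral_const_mul, integral_morseWeight_mul_pow hb hα']
    have h := laguerrePoly_sum_coeff_mul_Gamma hα (Nat.lt_succ_iff.1 (Finset.mem_range.1 hk))
    calc _ = P.coeff k * (1 / (2 * b)) ^ (α + 1) * ∑ j ∈ Finset.range (n + 1),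
          (laguerrePoly α n).coeff j * Gamma (α + 1 + (j + k : ℕ)) := by
          rw [Finset.mul_sum]; exact Finset.sum_congr rfl fun j _ => by ring
      _ = _ := by
        rw [h]
        split_ifs with hkn
        · subst hkn; ring
        · simp
  rw [Finset.sum_congr rfl e2]
  simp

/-- Orthogonality of the Laguerre functions, normalised. -/
lemma integral_morseFun_laguerrePoly {b s α : ℝ} (hb : 0 < b) (hα : -1 < α)
    (hs : s = (α + 1) / 2) (n m : ℕ) :
    ∫ x, morseFun b s (laguerrePoly α n) x * morseFun b s (laguerrePoly α m) x =
      if n = m then (1 / (2 * b)) ^ (α + 1) * (Gamma (α + n + 1) / n.factorial) else 0 := by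
  wlog hmn : m ≤ n generalizing n m
  · have := this m n (by omega)
    simp only [mul_comm (morseFun b s (laguerrePoly α m) _)] at this
    rw [this, if_neg (by omega), if_neg (by omega)]
  simp only [morseFun_mul_morseFun]
  rw [show 2 * s = α + 1 by rw [hs]; ring, integral_morseWeight_mul_laguerrePoly_mul hb hα
    ((laguerrePoly_natDegree_le α m).trans hmn)]
  split_ifs with h
  · subst h
    have h1 : (-1 : ℝ) ^ n * (-1) ^ n = 1 := by rw [← mul_pow]; simp
    rw [laguerrePoly_coeff_self]
    linear_combination (1 / (2 * b)) ^ (α + 1) * (Gamma (α + n + 1) / n.factorial) * h1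
  · rw [laguerrePoly_coeff_of_lt (by omega)]
    simp

end MorseFun

/-! ### Completeness -/

section Completeness

open Polynomial Real

lemma HasCompactSupport.exists_continuous_comp_eq {X Y E : Type*} [TopologicalSpace X]
    [TopologicalSpace Y] [T2Space Y] [TopologicalSpace E] [Zero E] {u : X → Y}
    (hu : Topology.IsOpenEmbedding u) {φ : X → E} (hφ : Continuous φ) (hc : HasCompactSupport φ) :
    ∃ h : Y → E, Continuous h ∧ ∀ x, h (u x) = φ x := by
  refine ⟨u.extend φ 0, continuous_of_tsupport fun y hy => ?_,
    fun x => hu.injective.extend_apply φ 0 x⟩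
  obtain ⟨x, -, rfl⟩ := hc.tsupport_extend_zero_subset hu.continuous hy
  rw [← hu.continuousAt_iff, Function.extend_comp hu.injective]
  exact hφ.continuousAt

lemma isOpenEmbedding_exp_neg_mul_exp_neg {τ : ℝ} (hτ : 0 < τ) :
    Topology.IsOpenEmbedding fun x : ℝ => exp (-τ * exp (-x)) := by
  have he : Topology.IsOpenEmbedding exp :=
    expPartialHomeomorph.isOpenEmbedding rfl
  exact he.comp ((Homeomorph.mulLeft₀ (-τ) (by linarith)).isOpenEmbedding.comp
    (he.comp (Homeomorph.neg ℝ).isOpenEmbedding))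

lemma integrable_morseWeight_smul {σ β : ℝ} (hσ : 0 < σ) (hβ : 0 < β) (f : L2R) :
    Integrable (fun x => morseWeight σ β x • f x) :=
  memLp_one_iff_integrable.1 ((Lp.memLp f).smul (memLp_two_morseWeight hσ hβ))

/-- If `f` annihilates all `z^{s+k} e^{-βz}`, `z = e^{-x}`, then it annihilates all
`z^{s+k} e^{-(β+τ)z}` for `0 < τ < β`: expand `e^{-τz}` in its power series, whose partial sums are
dominated by `e^{τz}`. -/
lemma integral_morseWeight_smul_eq_zero_of_add {s β τ : ℝ} (hs : 0 < s) (hτ : 0 < τ) (hβ : τ < β)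
    (f : L2R) (h : ∀ k : ℕ, ∫ x, morseWeight (s + k) β x • f x = 0) (k : ℕ) :
    ∫ x, morseWeight (s + k) (β + τ) x • f x = 0 := by
  have hexp : ∀ a : ℝ, HasSum (fun j : ℕ => a ^ j / (j.factorial : ℝ)) (exp a) := fun a => by
    rw [Real.exp_eq_exp_ℝ]; exact NormedSpace.expSeries_div_hasSum_exp a
  have hw : ∀ a x : ℝ, HasSum
      (fun j : ℕ => a ^ j / (j.factorial : ℝ) * morseWeight (s + (k + j : ℕ)) β x)
      (morseWeight (s + k) (β - a) x) := fun a x => by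
    have h1 := (hexp (a * exp (-x))).mul_left (morseWeight (s + k) β x)
    have e1 : morseWeight (s + k) β x * exp (a * exp (-x)) = morseWeight (s + k) (β - a) x := by
      simp only [morseWeight, ← Real.exp_add]; congr 1; ring
    rw [e1] at h1
    refine h1.congr_fun fun j => ?_
    rw [Nat.cast_add, ← add_assoc, ← morseWeight_mul_exp_pow (s + k), mul_pow]
    ring
  have hdom : ∀ x, HasSum
      (fun j : ℕ => τ ^ j / (j.factorial : ℝ) * morseWeight (s + (k + j : ℕ)) β x * ‖f x‖)
      (morseWeight (s + k) (β - τ) x * ‖f x‖) := fun x => (hw τ x).mul_right _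
  have hsum := hasSum_integral_of_dominated_convergence
    (F := fun (j : ℕ) x =>
      ((-τ) ^ j / (j.factorial : ℝ) * morseWeight (s + (k + j : ℕ)) β x) • f x)
    (f := fun x => morseWeight (s + k) (β + τ) x • f x) (μ := volume)
    (fun (j : ℕ) x => τ ^ j / (j.factorial : ℝ) * morseWeight (s + (k + j : ℕ)) β x * ‖f x‖)
    (fun j => ((continuous_morseWeight _ _).const_mul _).aestronglyMeasurable.smul
      (Lp.aestronglyMeasurable f))
    (fun j => Filter.Eventually.of_forall fun x => by
      rw [norm_smul, norm_mul, norm_div, norm_pow, norm_neg, Real.norm_of_nonneg hτ.le,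
        Real.norm_of_nonneg (morseWeight_pos _ _ _).le, RCLike.norm_natCast])
    (Filter.Eventually.of_forall fun x => (hdom x).summable)
    (by
      simp only [(hdom _).tsum_eq]
      refine (integrable_morseWeight_smul (by positivity : 0 < s + k)
        (by linarith : 0 < β - τ) f).norm.congr (Filter.Eventually.of_forall fun x => ?_)
      simp only [norm_smul, Real.norm_of_nonneg (morseWeight_pos _ _ _).le])
    (Filter.Eventually.of_forall fun x => by
      have := (hw (-τ) x).smul_const (f x)
      rwa [sub_neg_eq_add] at this)
  have hzero : ∀ j : ℕ, ∫ x, ((-τ) ^ j / (j.factorial : ℝ) *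
      morseWeight (s + (k + j : ℕ)) β x) • f x = 0 := fun j => by
    simp only [mul_smul]
    rw [integral_smul, h, smul_zero]
  simp only [hzero] at hsum
  exact hsum.unique hasSum_zero

/-- A function whose integrals against all powers of an open embedding `u : ℝ → [0, 1]` vanish is
zero: by the Weierstrass theorem the powers may be replaced by test functions. -/
lemma ae_eq_zero_of_integral_pow_smul_eq_zero {g : ℝ → ℂ} (hg : Integrable g) {u : ℝ → ℝ}
    (hu : Topology.IsOpenEmbedding u) (hu01 : ∀ x, u x ∈ Set.Icc (0 : ℝ) 1)
    (h : ∀ m : ℕ, ∫ x, u x ^ m • g x = 0) : g =ᵐ[volume] 0 := by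
  have hbdd : ∀ v : ℝ → ℝ, Continuous v → (∃ c, ∀ x, ‖v x‖ ≤ c) →
      Integrable (fun x => v x • g x) := fun v hv ⟨c, hc⟩ =>
    hg.bdd_smul c hv.aestronglyMeasurable (Filter.Eventually.of_forall hc)
  have hpow : ∀ m : ℕ, Integrable fun x => u x ^ m • g x := fun m =>
    hbdd _ (hu.continuous.pow m) ⟨1, fun x => by
      rw [Real.norm_of_nonneg (pow_nonneg (hu01 x).1 m)]
      exact pow_le_one₀ (hu01 x).1 (hu01 x).2⟩
  have hpoly : ∀ p : ℝ[X], Integrable (fun x => p.eval (u x) • g x) ∧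
      ∫ x, p.eval (u x) • g x = 0 := fun p => by
    induction p using Polynomial.induction_on' with
    | add P Q hP hQ =>
      simp only [eval_add, add_smul]
      exact ⟨hP.1.add hQ.1, by rw [integral_add hP.1 hQ.1, hP.2, hQ.2, add_zero]⟩
    | monomial k a =>
      simp only [eval_monomial, mul_smul]
      exact ⟨(hpow k).smul a, by rw [integral_smul, h, smul_zero]⟩
  refine ae_eq_zero_of_integral_contDiff_smul_eq_zero hg.locallyIntegrable fun φ hφ hc => ?_
  obtain ⟨v, hv, hvφ⟩ := hc.exists_continuous_comp_eq hu hφ.continuous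
  have hφi : Integrable fun x => φ x • g x :=
    hbdd _ hφ.continuous (hc.exists_bound_of_continuous hφ.continuous)
  rw [← norm_le_zero_iff]
  refine le_of_forall_pos_le_add fun ε hε => ?_
  have hG : 0 ≤ ∫ x, ‖g x‖ := integral_nonneg fun x => norm_nonneg _
  obtain ⟨p, hp⟩ := exists_polynomial_near_of_continuousOn 0 1 v hv.continuousOn
    (ε / ((∫ x, ‖g x‖) + 1)) (by positivity)
  calc ‖∫ x, φ x • g x‖ = ‖∫ x, (φ x • g x - p.eval (u x) • g x)‖ := by
        rw [integral_sub hφi (hpoly p).1, (hpoly p).2, sub_zero]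
    _ ≤ ∫ x, ε / ((∫ x, ‖g x‖) + 1) * ‖g x‖ := by
        refine norm_integral_le_of_norm_le (hg.norm.const_mul _)
          (Filter.Eventually.of_forall fun x => ?_)
        rw [← sub_smul, norm_smul, norm_sub_rev, ← hvφ]
        exact mul_le_mul_of_nonneg_right (hp _ (hu01 x)).le (norm_nonneg _)
    _ ≤ 0 + ε := by
        rw [integral_const_mul, zero_add, div_mul_eq_mul_div, div_le_iff₀ (by positivity)]
        nlinarith

/-- Completeness: the functions `z^s e^{-z/2} P(z)` have dense span in `L²(ℝ)`. -/
lemma eq_zero_of_forall_integral_morseFun_smul_eq_zero {b s : ℝ} (hb : 0 < b) (hs : 0 < s)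
    (f : L2R) (h : ∀ P : ℝ[X], ∫ x, morseFun b s P x • f x = 0) : f = 0 := by
  have h0 : ∀ k : ℕ, ∫ x, morseWeight (s + k) b x • f x = 0 := fun k => by
    have h1 := h (X ^ k)
    have e : ∀ x, morseFun b s (X ^ k) x • f x =
        ((2 * b) ^ k) • (morseWeight (s + k) b x • f x) := fun x => by
      rw [smul_smul, ← morseWeight_mul_exp_pow]
      simp only [morseFun, eval_pow, eval_X]
      congr 1; ring
    simp only [e] at h1
    rw [integral_smul] at h1
    exact (smul_eq_zero.1 h1).resolve_left (by positivity)
  -- increase the exponent `β` in steps of `b / 2`; at `k = 0` this yields the powers of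
  -- `u = exp (-(b / 2) e^{-x})` times the fixed weight
  have hstep : ∀ m k : ℕ, ∫ x, morseWeight (s + k) (b + m * (b / 2)) x • f x = 0 := fun m => by
    induction m with
    | zero => simpa using h0
    | succ m ih =>
      have := integral_morseWeight_smul_eq_zero_of_add hs (half_pos hb)
        (by nlinarith [Nat.cast_nonneg (α := ℝ) m] : b / 2 < b + m * (b / 2)) f ih
      intro k
      rw [show b + ((m + 1 : ℕ) : ℝ) * (b / 2) = b + m * (b / 2) + b / 2 by push_cast; ring]
      exact this k
  have hz := ae_eq_zero_of_integral_pow_smul_eq_zero (integrable_morseWeight_smul hs hb f)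
    (isOpenEmbedding_exp_neg_mul_exp_neg (half_pos hb))
    (fun x => ⟨(exp_pos _).le, exp_le_one_iff.2 (by nlinarith [exp_pos (-x)])⟩) (fun m => by
      have h1 := hstep m 0
      rw [← h1]
      congr 1
      ext1 x
      rw [smul_smul]
      congr 1
      simp only [morseWeight, ← Real.exp_add, ← Real.exp_nat_mul]
      congr 1; push_cast; ring)
  rw [Lp.eq_zero_iff_ae_eq_zero]
  filter_upwards [hz] with x hx
  exact (smul_eq_zero.1 hx).resolve_left (morseWeight_pos _ _ _).ne'

end Completeness

/-! ### The form domain and the operator -/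

section Operator

open Polynomial Filter Topology

/-- The defining identity of the `L²` weak derivative extends from test functions to smooth
functions that are square integrable together with their derivative, by cutting off. -/
lemma IsWeakDerivL2.integral_deriv_smul {f g : L2R} (h : IsWeakDerivL2 f g) {ψ : ℝ → ℝ}
    (hψ : ContDiff ℝ ∞ ψ) (h2 : MemLp ψ 2) (h2' : MemLp (deriv ψ) 2) :
    ∫ x, deriv ψ x • f x = -∫ x, ψ x • g x := by
  have hint : ∀ {φ : ℝ → ℝ} (k : L2R), MemLp φ 2 → Integrable (fun x => φ x • k x) :=
    fun k hφ => memLp_one_iff_integrable.1 ((Lp.memLp k).smul hφ)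
  let χ : ContDiffBump (0 : ℝ) := ⟨1, 2, one_pos, one_lt_two⟩
  have hχ : ContDiff ℝ ∞ (χ : ℝ → ℝ) := χ.contDiff
  have hχc : HasCompactSupport (χ : ℝ → ℝ) := χ.hasCompactSupport
  have hχ' : Continuous (deriv (χ : ℝ → ℝ)) := hχ.continuous_deriv (by simp)
  obtain ⟨M, hM⟩ := hχc.deriv.exists_bound_of_continuous hχ'
  -- the cutoffs `χ(a_n x)`, `a_n → 0`, converge to `1`, and their derivatives `a_n χ'(a_n x)` are
  -- bounded by `M` and tend to `0`
  let a : ℕ → ℝ := fun n => 1 / ((n : ℝ) + 1)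
  have ha0 : ∀ n, 0 < a n := fun n => by positivity
  have ha1 : ∀ n, a n ≤ 1 := fun n => by
    simp only [a]; rw [div_le_one (by positivity)]; linarith [Nat.cast_nonneg (α := ℝ) n]
  have ha : Tendsto a atTop (𝓝 0) := tendsto_one_div_add_atTop_nhds_zero_nat
  have hax : ∀ x : ℝ, Tendsto (fun n => a n * x) atTop (𝓝 0) := fun x => by
    simpa using ha.mul_const x
  have hχ1 : ∀ x, ‖χ x‖ ≤ 1 := fun x => by
    rw [Real.norm_of_nonneg χ.nonneg]; exact χ.le_one
  have hcut : ∀ n, ContDiff ℝ ∞ fun x => χ (a n * x) * ψ x := fun n =>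
    (hχ.comp (by fun_prop : ContDiff ℝ ∞ fun x : ℝ => a n * x)).mul hψ
  have hcutc : ∀ n, HasCompactSupport fun x => χ (a n * x) * ψ x := fun n =>
    (hχc.comp_homeomorph (Homeomorph.mulLeft₀ (a n) (ha0 n).ne')).mul_right
  have hderiv : ∀ n x, deriv (fun x => χ (a n * x) * ψ x) x =
      a n * deriv χ (a n * x) * ψ x + χ (a n * x) * deriv ψ x := fun n x => by
    have h1 := ((hχ.differentiable (by simp) (a n * x)).hasDerivAt.comp x
      ((hasDerivAt_id x).const_mul (a n)))
    have h3 := (hψ.differentiable (by simp) x).hasDerivAt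
    refine ((h1.mul h3).congr_deriv ?_).deriv
    simp only [Function.comp_apply]
    ring
  have hR : Tendsto (fun n => ∫ x, (χ (a n * x) * ψ x) • g x) atTop (𝓝 (∫ x, ψ x • g x)) := by
    refine tendsto_integral_of_dominated_convergence (fun x => ‖ψ x • g x‖)
      (fun n => (hcut n).continuous.aestronglyMeasurable.smul (Lp.aestronglyMeasurable g))
      (hint g h2).norm (fun n => Eventually.of_forall fun x => ?_)
      (Eventually.of_forall fun x => ?_)
    · rw [mul_smul, norm_smul]
      exact mul_le_of_le_one_left (norm_nonneg _) (hχ1 _)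
    · have h1 : Tendsto (fun n => χ (a n * x)) atTop (𝓝 1) := by
        rw [← χ.one_of_mem_closedBall (x := 0) (by simp [χ])]
        exact (hχ.continuous.tendsto 0).comp (hax x)
      simpa using (h1.mul_const (ψ x)).smul_const (g x)
  have hL : Tendsto (fun n => ∫ x, deriv (fun x => χ (a n * x) * ψ x) x • f x) atTop
      (𝓝 (∫ x, deriv ψ x • f x)) := by
    refine tendsto_integral_of_dominated_convergence
      (fun x => M * ‖ψ x • f x‖ + ‖deriv ψ x • f x‖)
      (fun n => ((hcut n).continuous_deriv (by simp)).aestronglyMeasurable.smul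
        (Lp.aestronglyMeasurable f))
      (((hint f h2).norm.const_mul M).add (hint f h2').norm)
      (fun n => Eventually.of_forall fun x => ?_)
      (Eventually.of_forall fun x => ?_)
    · rw [hderiv, add_smul, mul_smul _ (ψ x), mul_smul _ (deriv ψ x)]
      refine (norm_add_le _ _).trans (add_le_add ?_ ?_)
      · rw [norm_smul, norm_mul, Real.norm_of_nonneg (ha0 n).le]
        refine mul_le_mul_of_nonneg_right ?_ (norm_nonneg _)
        exact (mul_le_mul (ha1 n) (hM _) (norm_nonneg _) zero_le_one).trans (one_mul M).le
      · rw [norm_smul]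
        exact mul_le_of_le_one_left (norm_nonneg _) (hχ1 _)
    · simp only [hderiv]
      have h1 : Tendsto (fun n => χ (a n * x)) atTop (𝓝 1) := by
        rw [← χ.one_of_mem_closedBall (x := 0) (by simp [χ])]
        exact (hχ.continuous.tendsto 0).comp (hax x)
      have h3 : Tendsto (fun n => deriv χ (a n * x)) atTop (𝓝 (deriv χ 0)) :=
        (hχ'.tendsto 0).comp (hax x)
      simpa using ((((ha.mul h3).mul_const (ψ x)).add (h1.mul_const (deriv ψ x))).smul_const (f x))
  have heq : ∀ n, ∫ x, deriv (fun x => χ (a n * x) * ψ x) x • f x =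
      -∫ x, (χ (a n * x) * ψ x) • g x := fun n => h _ (hcut n) (hcutc n)
  simp only [heq] at hL
  exact tendsto_nhds_unique hL hR.neg

/-- The class in `L²(ℝ)` of `e^{-sx} e^{-b e^{-x}} P(2b e^{-x})`, as a linear map in `P`. -/
noncomputable def morseVec {b s : ℝ} (hb : 0 < b) (hs : 0 < s) : ℝ[X] →ₗ[ℝ] L2R where
  toFun P := ((memLp_morseFun hb hs P).ofReal (K := ℂ)).toLp _
  map_add' P Q := by
    rw [← MemLp.toLp_add]
    congr 1
    ext x
    simp [morseFun, mul_add]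
  map_smul' c P := by
    rw [RingHom.id_apply, ← MemLp.toLp_const_smul]
    congr 1
    ext x
    simp [morseFun]
    ring

variable {b s : ℝ} (hb : 0 < b) (hs : 0 < s)

lemma coeFn_morseVec (P : ℝ[X]) :
    (morseVec hb hs P : ℝ → ℂ) =ᵐ[volume] fun x => (morseFun b s P x : ℂ) :=
  MemLp.coeFn_toLp ((memLp_morseFun hb hs P).ofReal (K := ℂ))

lemma morseVec_C_mul (c : ℝ) (P : ℝ[X]) :
    morseVec hb hs (C c * P) = (c : ℂ) • morseVec hb hs P := by
  rw [← smul_eq_C_mul, map_smul]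
  exact RCLike.real_smul_eq_coe_smul (K := ℂ) c _

lemma inner_morseVec_left (P : ℝ[X]) (f : L2R) :
    inner ℂ (morseVec hb hs P) f = ∫ x, morseFun b s P x • f x := by
  rw [L2.inner_def]
  apply integral_congr_ae
  filter_upwards [coeFn_morseVec hb hs P] with x hx
  rw [hx]
  simp [mul_comm]

lemma inner_morseVec_morseVec (P Q : ℝ[X]) :
    inner ℂ (morseVec hb hs P) (morseVec hb hs Q) =
      ((∫ x, morseFun b s P x * morseFun b s Q x : ℝ) : ℂ) := by
  rw [inner_morseVec_left, ← integral_complex_ofReal]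
  apply integral_congr_ae
  filter_upwards [coeFn_morseVec hb hs Q] with x hx
  rw [hx]
  simp

lemma isWeakDerivL2_morseVec (P : ℝ[X]) :
    IsWeakDerivL2 (morseVec hb hs P) (morseVec hb hs (morseDerivPoly s P)) := by
  intro χ h1 h2
  have hd : Continuous (deriv χ) := h1.continuous_deriv (by simp)
  have e1 : ∫ x, deriv χ x • morseVec hb hs P x =
      ∫ x, ((deriv χ x * morseFun b s P x : ℝ) : ℂ) := by
    apply integral_congr_ae
    filter_upwards [coeFn_morseVec hb hs P] with x hx
    rw [hx]; simp
  have e2 : ∫ x, χ x • morseVec hb hs (morseDerivPoly s P) x =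
      ∫ x, ((χ x * morseFun b s (morseDerivPoly s P) x : ℝ) : ℂ) := by
    apply integral_congr_ae
    filter_upwards [coeFn_morseVec hb hs (morseDerivPoly s P)] with x hx
    rw [hx]; simp
  have hc := (contDiff_morseFun b s P).continuous
  have hc' := (contDiff_morseFun b s (morseDerivPoly s P)).continuous
  have key : ∫ x, χ x * morseFun b s (morseDerivPoly s P) x =
      -∫ x, deriv χ x * morseFun b s P x := by
    refine integral_mul_deriv_eq_deriv_mul_of_integrable
      (fun x _ => (h1.differentiable (by simp) x).hasDerivAt)
      (fun x _ => hasDerivAt_morseFun b s P x) ?_ ?_ ?_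
    · exact (h1.continuous.mul hc').integrable_of_hasCompactSupport h2.mul_right
    · exact (hd.mul hc).integrable_of_hasCompactSupport h2.deriv.mul_right
    · exact (h1.continuous.mul hc).integrable_of_hasCompactSupport h2.mul_right
  rw [e1, e2, integral_complex_ofReal, integral_complex_ofReal, key]
  simp

lemma morseVec_mem_morseFormDomain (P : ℝ[X]) :
    (morseVec hb hs P, morseVec hb hs (morseDerivPoly s P)) ∈ morseFormDomain b := by
  refine ⟨isWeakDerivL2_morseVec hb hs P, ?_⟩
  have hcont : Continuous fun x => Real.sqrt |morsePotential b x| * morseFun b s P x :=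
    (continuous_morsePotential b).abs.sqrt.mul (contDiff_morseFun b s P).continuous
  have h : MemLp (fun x => Real.sqrt |morsePotential b x| * morseFun b s P x) 2 := by
    rw [memLp_two_iff_integrable_sq hcont.aestronglyMeasurable]
    refine (integrable_morseFun_mul_morseFun hb hs
      ((C (1 / 4) * X ^ 2 - C b * X) * P) P).norm.congr (Eventually.of_forall fun x => ?_)
    dsimp only
    rw [← morsePotential_mul_morseFun, mul_pow, Real.sq_sqrt (abs_nonneg _), norm_mul, norm_mul,
      mul_assoc, Real.norm_eq_abs, Real.norm_eq_abs, abs_mul_abs_self, sq]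
  refine (memLp_congr_ae ?_).mp (h.ofReal (K := ℂ))
  filter_upwards [coeFn_morseVec hb hs P] with x hx
  rw [hx]
  simp

/-- The action of `-d²/dx² + q` on the functions `e^{-sx} e^{-b e^{-x}} P(2b e^{-x})`, transported
to the polynomial `P`. -/
noncomputable def morseSchrodingerPoly (b s : ℝ) (P : ℝ[X]) : ℝ[X] :=
  -morseDerivPoly s (morseDerivPoly s P) + (C (1 / 4) * X ^ 2 - C b * X) * P

lemma morseDiffExpr_morseFun (b s : ℝ) (P : ℝ[X]) (x : ℝ) :
    morseDiffExpr b (morseFun b s P) x = morseFun b s (morseSchrodingerPoly b s P) x := by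
  rw [morseDiffExpr, morsePotential_mul_morseFun, iteratedDeriv_succ, iteratedDeriv_one,
    deriv_morseFun, deriv_morseFun]
  simp only [morseSchrodingerPoly, morseFun, eval_add, eval_neg]
  ring

lemma morseVec_mem_morseGraph (P : ℝ[X]) :
    (morseVec hb hs P, morseVec hb hs (morseSchrodingerPoly b s P)) ∈ morseGraph b := by
  refine ⟨_, morseVec_mem_morseFormDomain hb hs P, fun p hp => ?_⟩
  have h1 : inner ℂ (morseVec hb hs (morseDerivPoly s P)) p.2 =
      -inner ℂ (morseVec hb hs (morseDerivPoly s (morseDerivPoly s P))) p.1 := by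
    rw [inner_morseVec_left, inner_morseVec_left]
    have h := hp.1.integral_deriv_smul (contDiff_morseFun b s (morseDerivPoly s P))
      (memLp_morseFun hb hs _) (by rw [deriv_morseFun]; exact memLp_morseFun hb hs _)
    rw [deriv_morseFun] at h
    rw [h, neg_neg]
  have h2 : ∫ x, (morsePotential b x : ℂ) * (starRingEnd ℂ (p.1 x) * morseVec hb hs P x) =
      starRingEnd ℂ (inner ℂ (morseVec hb hs ((C (1 / 4) * X ^ 2 - C b * X) * P)) p.1) := by
    rw [inner_morseVec_left, ← integral_conj]
    apply integral_congr_ae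
    filter_upwards [coeFn_morseVec hb hs P] with x hx
    rw [hx, ← morsePotential_mul_morseFun]
    simp
    ring
  rw [morseForm, h2, ← inner_conj_symm p.2, ← inner_conj_symm p.1 (morseVec hb hs _), h1,
    morseSchrodingerPoly, map_add (morseVec hb hs), map_neg (morseVec hb hs), inner_add_left, inner_neg_left, map_add]

lemma conj_morseForm (b : ℝ) (p r : L2R × L2R) :
    starRingEnd ℂ (morseForm b p r) = morseForm b r p := by
  rw [morseForm, morseForm, map_add, inner_conj_symm, ← integral_conj]
  congr 2
  ext x
  simp only [map_mul, Complex.conj_ofReal, Complex.conj_conj]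
  ring

/-- The operator is symmetric. -/
lemma inner_eq_inner_of_mem_morseGraph {u v : L2R × L2R} (hu : u ∈ morseGraph b)
    (hv : v ∈ morseGraph b) : inner ℂ u.2 v.1 = inner ℂ u.1 v.2 := by
  obtain ⟨u', hu', h1⟩ := hu
  obtain ⟨v', hv', h2⟩ := hv
  rw [← h2 _ hu', ← conj_morseForm, h1 _ hv', inner_conj_symm]

lemma mem_morseGraph_iff {u v : L2R} :
    (u, v) ∈ morseGraph b ↔ ∃ hu : u ∈ (morseOperator b).domain, morseOperator b ⟨u, hu⟩ = v := by
  rw [← morseOperator_graph, LinearPMap.mem_graph_iff]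
  constructor
  · rintro ⟨⟨y, hy⟩, rfl, h⟩
    exact ⟨hy, h⟩
  · rintro ⟨hu, h⟩
    exact ⟨⟨u, hu⟩, rfl, h⟩

end Operator

/-! ### The integer `N` and the normalised functions -/

lemma natCast_eq_floor_of_eq_ncard {b : ℝ} (hb : 0 < b) (hb' : ∀ k : ℕ, b ≠ 1 / 2 + k) {N : ℕ}
    (hN : N = Set.ncard {n : ℕ | (n : ℝ) < b - 1 / 2}) :
    (N : ℤ) = ⌊b + 1 / 2⌋ ∧ -1 < 2 * b - 2 * (N : ℝ) := by
  have hset : {n : ℕ | (n : ℝ) < b - 1 / 2} = Set.Iio ⌈b - 1 / 2⌉₊ := by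
    ext n; exact (Nat.lt_ceil (a := b - 1 / 2)).symm
  rw [hset, Set.ncard_eq_toFinset_card', Set.toFinset_Iio, Nat.card_Iio] at hN
  have h1 : b - 1 / 2 ≤ N := by rw [hN]; exact Nat.le_ceil _
  have h2 : (N : ℝ) < b + 1 / 2 := by
    rcases Nat.eq_zero_or_pos N with h0 | h0
    · rw [h0]; push_cast; linarith
    · have := (Nat.lt_ceil (n := N - 1) (a := b - 1 / 2)).1 (by omega)
      rw [Nat.cast_sub h0] at this
      push_cast at this
      linarith
  have h3 : b - 1 / 2 ≠ N := fun h => hb' N (by linarith)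
  refine ⟨?_, by linarith⟩
  rw [eq_comm, Int.floor_eq_iff]
  push_cast
  exact ⟨h2.le, by linarith [lt_of_le_of_ne h1 h3]⟩

section Normalised

open Polynomial

/-- The normalised Laguerre polynomial `P` for which `y_n = e^{-sx} e^{-b e^{-x}} P(2b e^{-x})`,
`s = b - N + 1/2`. -/
noncomputable def morseYPoly (b : ℝ) (N n : ℕ) : ℝ[X] :=
  C ((2 * b) ^ (b - N + 1 / 2) *
    Real.sqrt ((Nat.factorial n : ℝ) / Real.Gamma (2 * b - 2 * N + n + 1))) *
    laguerrePoly (2 * b - 2 * N) n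

lemma morseY_eq_morseFun (b : ℝ) (N n : ℕ) :
    morseY b N n = morseFun b (b - N + 1 / 2) (morseYPoly b N n) := by
  ext x
  simp only [morseY, morseFun, morseWeight, morseYPoly, eval_mul, eval_C]
  ring

/-- Consecutive normalising constants `√(n! / Γ(α+n+1))`. -/
lemma sqrt_mul_sqrt_factorial_div_Gamma {α : ℝ} (hα : -1 < α) (n : ℕ) :
    Real.sqrt (((n : ℝ) + 1) * (α + n + 1)) *
        Real.sqrt ((Nat.factorial (n + 1) : ℝ) / Real.Gamma (α + (n + 1 : ℕ) + 1)) =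
      (n + 1) * Real.sqrt ((Nat.factorial n : ℝ) / Real.Gamma (α + n + 1)) := by
  have hpos : 0 < α + n + 1 := by linarith [Nat.cast_nonneg (α := ℝ) n]
  have hG := Real.Gamma_pos_of_pos hpos
  have hn : (0 : ℝ) ≤ n + 1 := by positivity
  rw [← Real.sqrt_mul (by positivity), ← Real.sqrt_sq hn, ← Real.sqrt_mul (by positivity),
    Real.sqrt_sq hn]
  congr 1
  rw [Nat.factorial_succ, Nat.cast_succ, show α + (n + 1 : ℝ) + 1 = α + n + 1 + 1 by ring,
    Real.Gamma_add_one hpos.ne']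
  push_cast
  field_simp

/-- The tridiagonal formula on the level of polynomials. -/
lemma morseSchrodingerPoly_morseYPoly {b : ℝ} {N : ℕ} (hα : -1 < 2 * b - 2 * (N : ℝ)) (n : ℕ) :
    morseSchrodingerPoly b (b - N + 1 / 2) (morseYPoly b N n) =
      C (-(1 - (N : ℝ) + n) * Real.sqrt (((n : ℝ) + 1) * (2 * b - 2 * N + n + 1))) *
          morseYPoly b N (n + 1)
        + C (-((N : ℝ) - b - 1 / 2) ^ 2 + (1 - (N : ℝ) + n) * (2 * n + 2 * b - 2 * N + 1) - n) *
          morseYPoly b N n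
        - C (((n : ℝ) - N) * Real.sqrt ((n : ℝ) * (2 * b - 2 * N + n))) *
          morseYPoly b N (n - 1) := by
  set α := 2 * b - 2 * (N : ℝ) with hαdef
  set K := (2 * b) ^ (b - N + 1 / 2)
  let κ : ℕ → ℝ := fun n => Real.sqrt ((Nat.factorial n : ℝ) / Real.Gamma (α + n + 1))
  have hY : ∀ m, morseYPoly b N m = C (K * κ m) * laguerrePoly α m := fun m => rfl
  have hlin : ∀ (c s : ℝ) (P : ℝ[X]), morseDerivPoly s (C c * P) = C c * morseDerivPoly s P := by
    intro c s P
    simp only [morseDerivPoly, derivative_C_mul]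
    ring
  have hup : Real.sqrt (((n : ℝ) + 1) * (α + n + 1)) * κ (n + 1) = (n + 1) * κ n :=
    sqrt_mul_sqrt_factorial_div_Gamma hα n
  have hdown : C (κ n) * (C (n : ℝ) * laguerrePoly α n - X * derivative (laguerrePoly α n)) =
      C (Real.sqrt ((n : ℝ) * (α + n)) * κ (n - 1)) * laguerrePoly α (n - 1) := by
    cases n with
    | zero =>
      -- both sides vanish: `L_0` is constant and the square root has argument `0`
      simp [laguerrePoly]
    | succ m =>
      rw [Nat.add_sub_cancel]
      have hpos : 0 < α + m + 1 := by linarith [Nat.cast_nonneg (α := ℝ) m]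
      have h1 := sqrt_mul_sqrt_factorial_div_Gamma hα m
      have h2 : Real.sqrt (((m : ℝ) + 1) * (α + m + 1)) ^ 2 = ((m : ℝ) + 1) * (α + m + 1) :=
        Real.sq_sqrt (by positivity)
      have h3 : κ (m + 1) * (α + m + 1) =
          Real.sqrt (((m : ℝ) + 1) * (α + m + 1)) * κ m := by
        have hm : (m : ℝ) + 1 ≠ 0 := by positivity
        apply mul_left_cancel₀ hm
        change Real.sqrt (((m : ℝ) + 1) * (α + m + 1)) * κ (m + 1) = (m + 1) * κ m at h1
        linear_combination Real.sqrt (((m : ℝ) + 1) * (α + m + 1)) * h1 - κ (m + 1) * h2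
      have h4 := laguerrePoly_lowering α m
      push_cast at h4 ⊢
      rw [h4, ← add_assoc, ← h3]
      simp only [map_mul, map_add, map_one, map_natCast]
      ring
  have h := morsePoly_tridiagonal α N n (s := b - N + 1 / 2) (b := b)
    (by rw [hαdef]; ring) (by ring)
  rw [morseSchrodingerPoly, hY, hY, hY, hlin, hlin]
  have e1 : (C (-(1 - (N : ℝ) + n) * Real.sqrt (((n : ℝ) + 1) * (α + n + 1))) : ℝ[X]) *
      (C (K * κ (n + 1)) * laguerrePoly α (n + 1)) =
      C (K * κ n) * (C (-(1 - (N : ℝ) + n) * (n + 1)) * laguerrePoly α (n + 1)) := by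
    rw [← mul_assoc, ← mul_assoc, ← C_mul, ← C_mul]
    congr 2
    linear_combination (-(1 - (N : ℝ) + n)) * K * hup
  have e2 : (-((N : ℝ) - b - 1 / 2) ^ 2 + (1 - (N : ℝ) + n) * (2 * n + 2 * b - 2 * N + 1) - n) =
      -(b - N + 1 / 2) ^ 2 + (1 - N + n) * (2 * n + α + 1) - n := by rw [hαdef]; ring
  rw [e1, e2]
  simp only [C_mul] at h hdown ⊢
  linear_combination C K * C (κ n) * h - C K * C ((n : ℝ) - N) * hdown

lemma span_range_laguerrePoly (α : ℝ) :
    Submodule.span ℝ (Set.range (laguerrePoly α)) = ⊤ :=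
  Polynomial.Sequence.span ⟨laguerrePoly α, laguerrePoly_degree α⟩ fun i =>
    (leadingCoeff_ne_zero.2 (ne_zero_of_degree_gt
      (n := ⊥) (by rw [laguerrePoly_degree]; exact WithBot.bot_lt_coe i))).isUnit

variable {b : ℝ} {N : ℕ} (hb : 0 < b) (hs : 0 < b - N + 1 / 2)

lemma orthonormal_morseVec : Orthonormal ℂ fun n => morseVec hb hs (morseYPoly b N n) := by
  have hα : -1 < 2 * b - 2 * (N : ℝ) := by linarith
  rw [orthonormal_iff_ite]
  intro n m
  have e : ∀ x, morseFun b (b - N + 1 / 2) (morseYPoly b N n) x *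
      morseFun b (b - N + 1 / 2) (morseYPoly b N m) x =
      ((2 * b) ^ (b - N + 1 / 2) *
        Real.sqrt ((Nat.factorial n : ℝ) / Real.Gamma (2 * b - 2 * N + n + 1)) *
      ((2 * b) ^ (b - N + 1 / 2) *
        Real.sqrt ((Nat.factorial m : ℝ) / Real.Gamma (2 * b - 2 * N + m + 1)))) *
      (morseFun b (b - N + 1 / 2) (laguerrePoly (2 * b - 2 * N) n) x *
        morseFun b (b - N + 1 / 2) (laguerrePoly (2 * b - 2 * N) m) x) := fun x => by
    simp only [morseFun, morseYPoly, eval_mul, eval_C]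
    ring
  rw [inner_morseVec_morseVec]
  simp only [e]
  rw [integral_const_mul, integral_morseFun_laguerrePoly hb hα (by ring)]
  split_ifs with h
  · subst h
    have hG : 0 < Real.Gamma (2 * b - 2 * N + n + 1) :=
      Real.Gamma_pos_of_pos (by linarith [Nat.cast_nonneg (α := ℝ) n])
    have h1 : (2 * b) ^ (b - N + 1 / 2) * (2 * b) ^ (b - N + 1 / 2) *
        (1 / (2 * b)) ^ (2 * b - 2 * N + 1) = 1 := by
      rw [← Real.rpow_add (by positivity), show b - N + 1 / 2 + (b - N + 1 / 2) =
        2 * b - 2 * N + 1 by ring, ← Real.mul_rpow (by positivity) (by positivity),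
        mul_one_div_cancel (by positivity), Real.one_rpow]
    have h2 : Real.sqrt ((Nat.factorial n : ℝ) / Real.Gamma (2 * b - 2 * N + n + 1)) *
        Real.sqrt ((Nat.factorial n : ℝ) / Real.Gamma (2 * b - 2 * N + n + 1)) *
        (Real.Gamma (2 * b - 2 * N + n + 1) / Nat.factorial n) = 1 := by
      rw [Real.mul_self_sqrt (by positivity)]
      have := Nat.factorial_pos n
      rw [div_mul_div_cancel₀ hG.ne', div_self (by positivity)]
    rw [← Complex.ofReal_one]
    congr 1
    linear_combination Real.sqrt ((Nat.factorial n : ℝ) / Real.Gamma (2 * b - 2 * N + n + 1)) *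
      Real.sqrt ((Nat.factorial n : ℝ) / Real.Gamma (2 * b - 2 * N + n + 1)) *
        (Real.Gamma (2 * b - 2 * N + n + 1) / Nat.factorial n) * h1 + h2
  · simp

lemma orthogonal_span_range_morseVec :
    (Submodule.span ℂ (Set.range fun n => morseVec hb hs (morseYPoly b N n)))ᗮ = ⊥ := by
  rw [Submodule.eq_bot_iff]
  intro f hf
  have hL : ∀ n, inner ℂ (morseVec hb hs (laguerrePoly (2 * b - 2 * N) n)) f = 0 := by
    intro n
    have h1 := Submodule.inner_right_of_mem_orthogonal
      (Submodule.subset_span (Set.mem_range_self n)) hf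
    have hG : 0 < Real.Gamma (2 * b - 2 * N + n + 1) :=
      Real.Gamma_pos_of_pos (by linarith [Nat.cast_nonneg (α := ℝ) n])
    rw [morseYPoly, morseVec_C_mul, inner_smul_left, Complex.conj_ofReal] at h1
    exact (mul_eq_zero.1 h1).resolve_left (by
      have := Nat.factorial_pos n
      exact Complex.ofReal_ne_zero.2 (by positivity))
  refine eq_zero_of_forall_integral_morseFun_smul_eq_zero hb hs f fun P => ?_
  rw [← inner_morseVec_left hb hs]
  have hP : P ∈ Submodule.span ℝ (Set.range (laguerrePoly (2 * b - 2 * N))) := by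
    rw [span_range_laguerrePoly]; trivial
  induction hP using Submodule.span_induction with
  | mem x hx => obtain ⟨n, rfl⟩ := hx; exact hL n
  | zero => simp
  | add x y _ _ hx hy => rw [map_add, inner_add_left, hx, hy, add_zero]
  | smul a x _ hx => rw [smul_eq_C_mul, morseVec_C_mul, inner_smul_left, hx, mul_zero]

end Normalised

/-! ### Invariant subspaces -/

lemma HilbertBasis.topologicalClosure_span_image_compl {ι 𝕜 E : Type*} [RCLike 𝕜]
    [NormedAddCommGroup E] [InnerProductSpace 𝕜 E] (y : HilbertBasis ι 𝕜 E) (s : Set ι) :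
    (Submodule.span 𝕜 (y '' sᶜ)).topologicalClosure = (Submodule.span 𝕜 (y '' s))ᗮ := by
  apply le_antisymm
  · refine Submodule.topologicalClosure_minimal _ ?_ (Submodule.isClosed_orthogonal _)
    rw [Submodule.span_le]
    rintro _ ⟨i, hi, rfl⟩
    rw [SetLike.mem_coe, ← Submodule.span_singleton_le_iff_mem, ← Submodule.isOrtho_iff_le,
      Submodule.isOrtho_span]
    rintro _ rfl _ ⟨j, hj, rfl⟩
    exact y.orthonormal.2 fun h => hi (h ▸ hj)
  · intro x hx
    refine (Submodule.isClosed_topologicalClosure _).mem_of_tendsto (y.hasSum_repr x)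
      (Filter.Eventually.of_forall fun t => Submodule.sum_mem _ fun i _ => ?_)
    by_cases hi : i ∈ s
    · have := Submodule.inner_right_of_mem_orthogonal
        (Submodule.subset_span (Set.mem_image_of_mem y hi)) hx
      rw [y.repr_apply_apply, this, zero_smul]
      exact Submodule.zero_mem _
    · exact Submodule.smul_mem _ _ (Submodule.le_topologicalClosure _
        (Submodule.subset_span (Set.mem_image_of_mem y hi)))

section Invariant

variable {b : ℝ}

/-- If each member of `S` is mapped by the operator into the span of `S`, so is the span. -/
lemma exists_mem_morseGraph_of_mem_span {S : Set L2R}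
    (h : ∀ u ∈ S, ∃ v ∈ Submodule.span ℂ S, (u, v) ∈ morseGraph b) {u : L2R}
    (hu : u ∈ Submodule.span ℂ S) : ∃ v ∈ Submodule.span ℂ S, (u, v) ∈ morseGraph b := by
  induction hu using Submodule.span_induction with
  | mem x hx => exact h x hx
  | zero => exact ⟨0, Submodule.zero_mem _, (morseGraph b).zero_mem⟩
  | add x y _ _ hx hy =>
    obtain ⟨v, hv, hxv⟩ := hx
    obtain ⟨w, hw, hyw⟩ := hy
    exact ⟨v + w, Submodule.add_mem _ hv hw, (morseGraph b).add_mem hxv hyw⟩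
  | smul a x _ hx =>
    obtain ⟨v, hv, hxv⟩ := hx
    exact ⟨a • v, Submodule.smul_mem _ a hv, (morseGraph b).smul_mem a hxv⟩

lemma isInvariantUnder_of_forall_exists_mem_morseGraph {V : Submodule ℂ L2R}
    (h : ∀ u ∈ V, ∃ v ∈ V, (u, v) ∈ morseGraph b) : IsInvariantUnder (morseOperator b) V := by
  intro f hf
  obtain ⟨v, hv, hfv⟩ := h f hf
  obtain ⟨_, h'⟩ := mem_morseGraph_iff.1 hfv
  exact h' ▸ hv

/-- By symmetry, the orthogonal complement of an invariant subspace of the domain is invariant. -/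
lemma isInvariantUnder_orthogonal_of_forall_exists_mem_morseGraph {V : Submodule ℂ L2R}
    (h : ∀ u ∈ V, ∃ v ∈ V, (u, v) ∈ morseGraph b) : IsInvariantUnder (morseOperator b) Vᗮ := by
  intro f hf
  rw [Submodule.mem_orthogonal]
  intro u hu
  obtain ⟨v, hv, huv⟩ := h u hu
  have hfg : ((f : L2R), morseOperator b f) ∈ morseGraph b := mem_morseGraph_iff.2 ⟨f.2, rfl⟩
  rw [← inner_eq_inner_of_mem_morseGraph huv hfg]
  exact Submodule.inner_right_of_mem_orthogonal hv hf

end Invariant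

theorem mainTheorem7 (b : ℝ) (hb : 0 < b) (hb' : ∀ k : ℕ, b ≠ 1 / 2 + k)
    (N : ℕ) (hN : N = Set.ncard {n : ℕ | (n : ℝ) < b - 1 / 2}) :
    ((N : ℤ) = ⌊b + 1 / 2⌋ ∧ -1 < 2 * b - 2 * (N : ℝ)) ∧
    -- the functions are smooth and the tridiagonal formula holds pointwise
    (∀ n : ℕ, ContDiff ℝ ∞ (morseY b N n)) ∧
    (∀ (n : ℕ) (x : ℝ), morseDiffExpr b (morseY b N n) x =
      -(1 - (N : ℝ) + n) * Real.sqrt (((n : ℝ) + 1) * (2 * b - 2 * N + n + 1))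
          * morseY b N (n + 1) x
        + (-((N : ℝ) - b - 1 / 2) ^ 2 + (1 - (N : ℝ) + n) * (2 * n + 2 * b - 2 * N + 1) - n)
          * morseY b N n x
        - ((n : ℝ) - N) * Real.sqrt ((n : ℝ) * (2 * b - 2 * N + n)) * morseY b N (n - 1) x) ∧
    -- the functions form an orthonormal basis of `L²(ℝ)`
    ∃ y : HilbertBasis ℕ ℂ L2R,
      (∀ n : ℕ, (y n : ℝ → ℂ) =ᵐ[volume] fun x => (morseY b N n x : ℂ)) ∧
      -- they lie in the domain of the operator, which acts on them tridiagonally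
      (∀ n : ℕ, ∃ hn : y n ∈ (morseOperator b).domain,
        morseOperator b ⟨y n, hn⟩ =
          ((-(1 - (N : ℝ) + n) * Real.sqrt (((n : ℝ) + 1) * (2 * b - 2 * N + n + 1)) : ℝ) : ℂ)
              • y (n + 1)
            + ((-((N : ℝ) - b - 1 / 2) ^ 2
                + (1 - (N : ℝ) + n) * (2 * n + 2 * b - 2 * N + 1) - n : ℝ) : ℂ) • y n
            - ((((n : ℝ) - N) * Real.sqrt ((n : ℝ) * (2 * b - 2 * N + n)) : ℝ) : ℂ)
              • y (n - 1)) ∧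
      -- the two complementary invariant subspaces
      Submodule.span ℂ (y '' {n | n < N}) ≤ (morseOperator b).domain ∧
      IsInvariantUnder (morseOperator b) (Submodule.span ℂ (y '' {n | n < N})) ∧
      IsInvariantUnder (morseOperator b)
        (Submodule.span ℂ (y '' {n | N ≤ n})).topologicalClosure ∧
      Module.finrank ℂ (Submodule.span ℂ (y '' {n | n < N})) = N ∧
      (Submodule.span ℂ (y '' {n | N ≤ n})).topologicalClosure =
        (Submodule.span ℂ (y '' {n | n < N}))ᗮ := by
  obtain ⟨hfloor, hα⟩ := natCast_eq_floor_of_eq_ncard hb hb' hN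
  have hs : 0 < b - N + 1 / 2 := by linarith
  refine ⟨⟨hfloor, hα⟩, fun n => ?_, fun n x => ?_, ?_⟩
  · rw [morseY_eq_morseFun]
    exact contDiff_morseFun _ _ _
  · simp only [morseY_eq_morseFun]
    rw [morseDiffExpr_morseFun, morseSchrodingerPoly_morseYPoly hα]
    simp only [morseFun, Polynomial.eval_add, Polynomial.eval_sub, Polynomial.eval_mul,
      Polynomial.eval_C]
    ring
  let y : HilbertBasis ℕ ℂ L2R := HilbertBasis.mkOfOrthogonalEqBot
    (orthonormal_morseVec hb hs) (orthogonal_span_range_morseVec hb hs)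
  have hy : ∀ n, y n = morseVec hb hs (morseYPoly b N n) := fun n =>
    congrFun (HilbertBasis.coe_mkOfOrthogonalEqBot _ _) n
  have hgraph : ∀ n : ℕ, (y n,
      ((-(1 - (N : ℝ) + n) * Real.sqrt (((n : ℝ) + 1) * (2 * b - 2 * N + n + 1)) : ℝ) : ℂ)
          • y (n + 1)
        + ((-((N : ℝ) - b - 1 / 2) ^ 2
            + (1 - (N : ℝ) + n) * (2 * n + 2 * b - 2 * N + 1) - n : ℝ) : ℂ) • y n
        - ((((n : ℝ) - N) * Real.sqrt ((n : ℝ) * (2 * b - 2 * N + n)) : ℝ) : ℂ)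
          • y (n - 1)) ∈ morseGraph b := fun n => by
    rw [hy, hy, hy, ← morseVec_C_mul, ← morseVec_C_mul, ← morseVec_C_mul, ← map_add, ← map_sub,
      ← morseSchrodingerPoly_morseYPoly hα]
    exact morseVec_mem_morseGraph hb hs _
  -- the coefficient of `y (n + 1)` vanishes at `n = N - 1`, so the first `N` functions do not
  -- couple to the others
  have hspan : ∀ u ∈ Submodule.span ℂ (y '' {n | n < N}),
      ∃ v ∈ Submodule.span ℂ (y '' {n | n < N}), (u, v) ∈ morseGraph b := fun u hu => by
    refine exists_mem_morseGraph_of_mem_span ?_ hu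
    rintro _ ⟨n, hn, rfl⟩
    have hmem : ∀ m < N, y m ∈ Submodule.span ℂ (y '' {n | n < N}) := fun m hm =>
      Submodule.subset_span (Set.mem_image_of_mem y hm)
    refine ⟨_, Submodule.sub_mem _ (Submodule.add_mem _ ?_ (Submodule.smul_mem _ _ (hmem n hn)))
      (Submodule.smul_mem _ _ (hmem (n - 1) ((Nat.sub_le n 1).trans_lt hn))), hgraph n⟩
    rcases Nat.lt_or_ge (n + 1) N with h | h
    · exact Submodule.smul_mem _ _ (hmem _ h)
    · have hn' : n < N := hn
      obtain rfl : N = n + 1 := by omega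
      simp
  have hcompl : {n | N ≤ n} = {n | n < N}ᶜ := by ext n; simp
  refine ⟨y, fun n => ?_, fun n => mem_morseGraph_iff.1 (hgraph n), fun u hu => ?_,
    isInvariantUnder_of_forall_exists_mem_morseGraph hspan, ?_, ?_, ?_⟩
  · rw [hy, morseY_eq_morseFun]
    exact coeFn_morseVec hb hs _
  · obtain ⟨v, -, huv⟩ := hspan u hu
    exact (mem_morseGraph_iff.1 huv).1
  · rw [hcompl, y.topologicalClosure_span_image_compl]
    exact isInvariantUnder_orthogonal_of_forall_exists_mem_morseGraph hspan
  · have hrange : y '' {n | n < N} = Set.range (y ∘ ((↑) : Fin N → ℕ)) := by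
      ext u
      exact ⟨fun ⟨n, hn, h⟩ => ⟨⟨n, hn⟩, h⟩, fun ⟨i, h⟩ => ⟨i, i.2, h⟩⟩
    rw [hrange, finrank_span_eq_card
      (y.orthonormal.linearIndependent.comp _ Fin.val_injective), Fintype.card_fin]
  · rw [hcompl, y.topologicalClosure_span_image_compl]
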